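/- **Setting.** Let $f:\mathbb R^D\times\mathbb R^P\to\mathbb R^K$ be a measurable function (a network with input $x$ and parameter $\theta$), $\mathrm{err}:\mathbb R^K\times\mathbb R^K\to[0,1]$ a measurable error function, $\mathcal D$ a probability distribution on $\mathbb R^D\times\mathbb R^K$, and let $\alpha,\sigma>0$ and $\delta\in(0,1]$. Let $\mathcal S=\mathcal S_{\mathbb P}\sqcup\mathcal S_{\mathbb Q}$ be an i.i.d. sample from $\mathcal D$, split into two parts, with $N_{\mathbb Q}=|\mathcal S_{\mathbb Q}|\ge 1$. Let $\theta^*\in\mathbb R^P$ be a (random) pre-trained parameter that is independent of $\mathcal S_{\mathbb Q}$, for example one computed from $\mathcal S_{\mathbb P}$ and from training randomness independent of the data. Let $(x_i,y_i)_{i\in R}$ be the examples used for a Bayesian linear regression: all of $\mathcal S$, or more generally any fixed subset of the positions in $\mathcal S$ (such as those of $\mathcal S_{\mathbb Q}$). Assume that, almost surely, $f(x_i,\cdot)$ is differentiable at $\theta^*$ for all $i\in R$. For a parameter $\theta$ let $\mathbf J_\theta(x,\theta)\in\mathbb R^{K\times P}$ be the Jacobian of $f(x,\cdot)$ at $\theta$.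 Let $\mathbf J_c$ be the matrix obtained by stacking the blocks $\mathbf J_\theta(x_i,\theta)\,\mathrm{diag}(\theta)$, $i\in R$, and let $r$ be the vector obtained by stacking $y_i-f(x_i,\theta)$, $i\in R$. Put $$\mathbb P=\mathcal N(0,\alpha^2 I_P),\qquad \mathbb Q_\theta=\mathcal N(\mu_{\mathbb Q},\Sigma_{\mathbb Q}),\qquad \Sigma_{\mathbb Q}=\Big(\tfrac{I_P}{\alpha^2}+\tfrac{\mathbf J_c^\top \mathbf J_c}{\sigma^2}\Big)^{-1},\qquad \mu_{\mathbb Q}=\frac{\Sigma_{\mathbb Q}\mathbf J_c^\top r}{\sigma^2}.$$ These are distributions of a connectivity vector $c\in\mathbb R^P$, and $c$ corresponds to the parameter $\psi=\theta+\theta\odot c$. Let $\mathrm{err}_{\mathcal D}(\mathbb Q_\theta)=\mathbb E_{(x,y)\sim\mathcal D,\,c\sim\mathbb Q_\theta}[\mathrm{err}(f(x,\theta+\theta\odot c),y)]$, and let $\mathrm{err}_{\mathcal S_{\mathbb Q}}(\mathbb Q_\theta)$ be the average over $(x,y)\in\mathcal S_{\mathbb Q}$ of $\mathbb E_{c\sim\mathbb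 Q_\theta}[\mathrm{err}(f(x,\theta+\theta\odot c),y)]$. Let $\beta_1,\dots,\beta_P$ be the eigenvalues, with multiplicity, of $\big(I_P+\frac{\alpha^2}{\sigma^2}\mathbf J_c^\top\mathbf J_c\big)^{-1}$, and let $h(x)=x-\log x-1$. **Theorem (PAC-Bayes-CTK and its invariance).** 1. With probability at least $1-\delta$, for $\theta=\theta^*$, $$\mathrm{err}_{\mathcal D}(\mathbb Q_{\theta^*})\le \mathrm{err}_{\mathcal S_{\mathbb Q}}(\mathbb Q_{\theta^*})+\sqrt{\frac{\mu_{\mathbb Q}^\top\mu_{\mathbb Q}}{4\alpha^2N_{\mathbb Q}}+\sum_{i=1}^P\frac{h(\beta_i)}{4N_{\mathbb Q}}+\frac{\log(2\sqrt{N_{\mathbb Q}}/\delta)}{2N_{\mathbb Q}}}.$$ 2. For every parameter value $\theta$ and every value of the sample such that $f(x_i,\cdot)$ is differentiable at $\theta$ for all $i\in R$, the first two terms under the root are the Kullback–Leibler part of the bound: $$\mathrm{KL}[\mathbb Q_\theta\,\|\,\mathbb P]=\frac{\mu_{\mathbb Q}^\top\mu_{\mathbb Q}}{2\alpha^2}+\frac12\sum_{i=1}^P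 h(\beta_i).$$ 3. For the same $\theta$ and samples, let $\mathcal T:\mathbb R^P\to\mathbb R^P$ be any invertible diagonal linear map with $f(x,\mathcal T(\psi))=f(x,\psi)$ for all $x\in\mathbb R^D$ and $\psi\in\mathbb R^P$. Then both sides of the inequality in part 1, evaluated with $\theta$ in place of $\theta^*$, are unchanged when $\theta$ is replaced by $\mathcal T(\theta)$. -/

import Mathlib

open MeasureTheory ProbabilityTheory InformationTheory
open scoped Matrix ENNReal

noncomputable section

namespace PACBayesCTK

/-- `ℝⁿ` with its Euclidean structure. -/
abbrev Vec (n : ℕ) : Type := EuclideanSpace ℝ (Fin n)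

/-- A labelled example `(x, y)` with `x ∈ ℝᴰ` and `y ∈ ℝᴷ`. -/
abbrev Example (D K : ℕ) : Type := Vec D × Vec K

/-- Component-wise (Hadamard) product of two vectors. -/
def hadamard {P : ℕ} (a b : Vec P) : Vec P := WithLp.toLp 2 (fun p => a p * b p)

/-- The perturbed parameter `ψ = θ + θ ⊙ c` belonging to the connectivity vector `c`. -/
def perturb {P : ℕ} (θ c : Vec P) : Vec P := θ + hadamard θ c

/-- The Jacobian `J_θ(x, θ) ∈ ℝ^{K × P}` of the network `f` with respect to the parameter. -/
def jacobian {D P K : ℕ} (f : Vec D → Vec P → Vec K) (x : Vec D) (θ : Vec P) :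
    Matrix (Fin K) (Fin P) ℝ :=
  Matrix.of fun k p => (fderiv ℝ (f x) θ (EuclideanSpace.single p 1)) k

/-- The Jacobian with respect to connectivity: the blocks `J_θ(x_i, θ) diag(θ)`, stacked along the
examples `z i = (x_i, y_i)`. -/
def connJacobian {ι : Type*} {D P K : ℕ} (f : Vec D → Vec P → Vec K) (z : ι → Example D K)
    (θ : Vec P) : Matrix (ι × Fin K) (Fin P) ℝ :=
  Matrix.of fun ik p => (jacobian f (z ik.1).1 θ * Matrix.diagonal (fun q => θ q)) ik.2 p

/-- The stacked residual `𝒴 - f(𝒳, θ)`. -/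
def residual {ι : Type*} {D P K : ℕ} (f : Vec D → Vec P → Vec K) (z : ι → Example D K)
    (θ : Vec P) : ι × Fin K → ℝ :=
  fun ik => (z ik.1).2 ik.2 - f (z ik.1).1 θ ik.2

/-- The prior `N(0, α² I)` over connectivity. -/
def prior (P : ℕ) (α : ℝ) : Measure (Vec P) :=
  multivariateGaussian 0 (α ^ 2 • (1 : Matrix (Fin P) (Fin P) ℝ))

/-- The posterior covariance `(I / α² + J_cᵀ J_c / σ²)⁻¹`. -/
def postCov {ι : Type*} [Fintype ι] {D P K : ℕ} (f : Vec D → Vec P → Vec K)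
    (z : ι → Example D K) (θ : Vec P) (α σ : ℝ) : Matrix (Fin P) (Fin P) ℝ :=
  ((1 / α ^ 2) • (1 : Matrix (Fin P) (Fin P) ℝ)
    + (1 / σ ^ 2) • ((connJacobian f z θ)ᵀ * connJacobian f z θ))⁻¹

/-- The posterior mean `Σ_Q J_cᵀ (𝒴 - f(𝒳, θ)) / σ²`. -/
def postMean {ι : Type*} [Fintype ι] {D P K : ℕ} (f : Vec D → Vec P → Vec K)
    (z : ι → Example D K) (θ : Vec P) (α σ : ℝ) : Vec P :=
  WithLp.toLp 2 ((1 / σ ^ 2) •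
    ((postCov f z θ α σ * (connJacobian f z θ)ᵀ) *ᵥ residual f z θ))

/-- The posterior `N(μ_Q, Σ_Q)` over connectivity: the posterior of the Bayesian linear regression
`y_i = f(x_i, θ) + J_θ(x_i, θ) diag(θ) c + ε_i` with `ε_i ∼ N(0, σ² I)` and `c ∼ N(0, α² I)`. -/
def posterior {ι : Type*} [Fintype ι] {D P K : ℕ} (f : Vec D → Vec P → Vec K)
    (z : ι → Example D K) (θ : Vec P) (α σ : ℝ) : Measure (Vec P) :=
  multivariateGaussian (postMean f z θ α σ) (postCov f z θ α σ)

/-- The posterior over parameters: the law of `θ + θ ⊙ c` for `c` drawn from the posterior. -/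
def paramPosterior {ι : Type*} [Fintype ι] {D P K : ℕ} (f : Vec D → Vec P → Vec K)
    (z : ι → Example D K) (θ : Vec P) (α σ : ℝ) : Measure (Vec P) :=
  (posterior f z θ α σ).map (perturb θ)

/-- Generalization error `E_{(x,y) ∼ 𝒟, ψ ∼ Q} [err (f(x,ψ), y)]`. -/
def genErr {D P K : ℕ} (f : Vec D → Vec P → Vec K) (err : Vec K → Vec K → ℝ)
    (𝒟 : Measure (Example D K)) (Q : Measure (Vec P)) : ℝ :=
  ∫ w, err (f w.1.1 w.2) w.1.2 ∂(𝒟.prod Q)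

/-- Empirical error on the sample `z`: the average over `i` of `E_{ψ ∼ Q} [err (f(x_i,ψ), y_i)]`. -/
def empErr {D P K N : ℕ} (f : Vec D → Vec P → Vec K) (err : Vec K → Vec K → ℝ)
    (z : Fin N → Example D K) (Q : Measure (Vec P)) : ℝ :=
  (1 / (N : ℝ)) * ∑ i, ∫ ψ, err (f (z i).1 ψ) (z i).2 ∂Q

/-- The matrix `(I + (α² / σ²) J_cᵀ J_c)⁻¹`. -/
def sharpnessMatrix {ι : Type*} [Fintype ι] {D P K : ℕ} (f : Vec D → Vec P → Vec K)
    (z : ι → Example D K) (θ : Vec P) (α σ : ℝ) : Matrix (Fin P) (Fin P) ℝ :=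
  (1 + (α ^ 2 / σ ^ 2) • ((connJacobian f z θ)ᵀ * connJacobian f z θ))⁻¹

theorem sharpnessMatrix_isHermitian {ι : Type*} [Fintype ι] {D P K : ℕ}
    (f : Vec D → Vec P → Vec K) (z : ι → Example D K) (θ : Vec P) (α σ : ℝ) :
    (sharpnessMatrix f z θ α σ).IsHermitian := by
  unfold sharpnessMatrix
  refine Matrix.IsHermitian.inv ?_
  rw [Matrix.IsHermitian, Matrix.conjTranspose_eq_transpose_of_trivial]
  simp [Matrix.transpose_mul]

/-- The eigenvalues `β_i`, `1 ≤ i ≤ P`, of `(I + (α² / σ²) J_cᵀ J_c)⁻¹`, with multiplicity. -/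
def beta {ι : Type*} [Fintype ι] {D P K : ℕ} (f : Vec D → Vec P → Vec K)
    (z : ι → Example D K) (θ : Vec P) (α σ : ℝ) : Fin P → ℝ :=
  (sharpnessMatrix_isHermitian f z θ α σ).eigenvalues

/-- `h(x) = x - log x - 1`. -/
def h (x : ℝ) : ℝ := x - Real.log x - 1

/-- The right-hand side of the PAC-Bayes-CTK bound. The training sample `s` consists of a first part
(indices `Sum.inl`) and a second part (indices `Sum.inr`); `R` is the set of (indices of) examples
that enter the Bayesian linear regression. -/
def ctkBound {D P K NP NQ : ℕ} (f : Vec D → Vec P → Vec K) (err : Vec K → Vec K → ℝ)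
    (s : Fin NP ⊕ Fin NQ → Example D K) (R : Finset (Fin NP ⊕ Fin NQ)) (θ : Vec P)
    (α σ δ : ℝ) : ℝ :=
  let z : R → Example D K := fun i => s i
  let μ : Vec P := postMean f z θ α σ
  let β : Fin P → ℝ := beta f z θ α σ
  empErr f err (fun j => s (Sum.inr j)) (paramPosterior f z θ α σ)
    + √((∑ p, μ p * μ p) / (4 * α ^ 2 * NQ) + ∑ p, h (β p) / (4 * NQ)
        + Real.log (2 * √(NQ : ℝ) / δ) / (2 * NQ))

/-- The linear map `T` is diagonal: it multiplies each coordinate by a fixed number. -/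
def IsDiagonal {P : ℕ} (T : Vec P ≃ₗ[ℝ] Vec P) : Prop :=
  ∃ t : Fin P → ℝ, ∀ ψ p, T ψ p = t p * ψ p

end PACBayesCTK

end

/-! The bound is the PAC-Bayes argument with the constant `2 * √N`, where `N` is the size of the
second part of the sample. Let gap(c) be expected minus empirical error, on that part, of the
network with connectivity `c`. For fixed `θ` and `c` the errors are i.i.d. in [0, 1], and E exp(2N
gap²) ≤ 2√N (`lintegral_exp_sq_le`): convexity reduces to Bernoulli errors, Pinsker's inequality
removes the unknown mean, and Stirling's formula bounds the remaining binomial sum. The prior is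
fixed and `θ` is independent of the second part, so Tonelli and Markov give, outside an event of
probability at most `δ`, a prior average of exp(2N gap²) below 2√N/δ. This event does not involve
the posterior. On its complement the Donsker–Varadhan inequality therefore applies to every
posterior of finite divergence, even one fitted to the same data, and Jensen's inequality passes
from E gap² to (E gap)².

For the divergence formula, the posterior covariance is `α ^ 2` times `sharpnessMatrix` and the
prior is isotropic. In an eigenbasis both are products of one-dimensional Gaussians, divergences add
up, and the variance ratios are the `beta`.

For the invariance, let T = diag(t) preserve `f`. The chain rule gives J(Tθ) diag(t) = J(θ), while
diag(Tθ) = diag(t) diag(θ), so the connectivity Jacobian is unchanged, and so is the residual. Hence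
the law of `c` is the same, and the law of the parameter is only pushed forward by `T`, which `f`
does not see. -/

namespace PACBayesCTK

/-! ### Stirling estimate of the binomial maximum-likelihood sum. -/

theorem sum_one_div_sqrt_le (m : ℕ) :
    ∑ k ∈ Finset.range (m + 1), 1 / √((k : ℝ) + 1) ≤ 2 * √((m : ℝ) + 1) - 1 := by
  induction m with
  | zero => norm_num
  | succ m ih =>
    rw [Finset.sum_range_succ]
    have h1 : (0 : ℝ) < √((m : ℝ) + 1) := by positivity
    have h2 : (0 : ℝ) < √((m : ℝ) + 1 + 1) := by positivity
    have e1 : √((m : ℝ) + 1) ^ 2 = m + 1 := Real.sq_sqrt (by positivity)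
    have e2 : √((m : ℝ) + 1 + 1) ^ 2 = m + 1 + 1 := Real.sq_sqrt (by positivity)
    have : 1 / √((m : ℝ) + 1 + 1) ≤ 2 * √((m : ℝ) + 1 + 1) - 2 * √((m : ℝ) + 1) := by
      rw [div_le_iff₀ h2]
      nlinarith [sq_nonneg (√((m : ℝ) + 1 + 1) - √((m : ℝ) + 1))]
    push_cast
    linarith

theorem one_div_sqrt_mul_le {a b n : ℝ} (ha : 0 < a) (hb : 0 < b) (hn : a + b = n) :
    1 / √(a * b) ≤ (1 / √n) * (1 / √a + 1 / √b) := by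
  have hn0 : 0 < n := by linarith
  have h1 := Real.sqrt_pos.2 ha
  have h2 := Real.sqrt_pos.2 hb
  have h3 := Real.sqrt_pos.2 hn0
  have hle : √n ≤ √a + √b := by
    rw [Real.sqrt_le_left (by positivity)]
    nlinarith [Real.sq_sqrt ha.le, Real.sq_sqrt hb.le]
  rw [Real.sqrt_mul ha.le]
  calc 1 / (√a * √b) = (1 / √n) * (√n / (√a * √b)) := by field_simp
    _ ≤ (1 / √n) * ((√a + √b) / (√a * √b)) := by gcongr
    _ = _ := by field_simp; ring

/-- Writing each factorial through `stirlingSeq`, all powers cancel and s(a+b+2) / (s(a+1) s(b+1))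
remains. It is at most 1/√π because `stirlingSeq` decreases to √π. The shifts by one keep every
index positive. -/
theorem choose_mul_pow_le (a b : ℕ) :
    ((a + b + 2).choose (a + 1) : ℝ) * (((a : ℝ) + 1) / (a + b + 2)) ^ (a + 1)
      * (((b : ℝ) + 1) / (a + b + 2)) ^ (b + 1)
      ≤ √((a : ℝ) + b + 2) / √(2 * Real.pi) * (1 / √(((a : ℝ) + 1) * (b + 1))) := by
  have key : ∀ n : ℕ, ((n + 1).factorial : ℝ) = Stirling.stirlingSeq (n + 1)
      * (√(2 * ((n : ℝ) + 1)) * (((n : ℝ) + 1) / Real.exp 1) ^ (n + 1)) := by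
    intro n
    unfold Stirling.stirlingSeq
    push_cast
    field_simp
  have hanti : Stirling.stirlingSeq (a + b + 1 + 1) ≤ Stirling.stirlingSeq (a + 1) :=
    Stirling.stirlingSeq'_antitone (show a ≤ a + b + 1 by omega)
  have hpi : √Real.pi ≤ Stirling.stirlingSeq (b + 1) := Stirling.sqrt_pi_le_stirlingSeq (by omega)
  have hsa : 0 < Stirling.stirlingSeq (a + 1) := Stirling.stirlingSeq'_pos a
  have hsb : 0 < Stirling.stirlingSeq (b + 1) := Stirling.stirlingSeq'_pos b
  have hspi : 0 < √Real.pi := Real.sqrt_pos.2 Real.pi_pos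
  have hc : ((a + b + 2).choose (a + 1) : ℝ)
      = (a + b + 1 + 1).factorial / ((a + 1).factorial * (b + 1).factorial) := by
    rw [Nat.cast_choose ℝ (by omega : a + 1 ≤ a + b + 2)]
    congr 3
    congr 1
    omega
  rw [hc, key, key, key]
  push_cast
  have e2 : (a : ℝ) + b + 1 + 1 = a + b + 2 := by ring
  rw [e2]
  have ha0 : (0 : ℝ) < (a : ℝ) + 1 := by positivity
  have hb0 : (0 : ℝ) < (b : ℝ) + 1 := by positivity
  have hn0 : (0 : ℝ) < (a : ℝ) + b + 2 := by positivity
  rw [Real.sqrt_mul (by norm_num : (0:ℝ) ≤ 2), Real.sqrt_mul (by norm_num : (0:ℝ) ≤ 2),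
    Real.sqrt_mul (by norm_num : (0:ℝ) ≤ 2), Real.sqrt_mul (by norm_num : (0:ℝ) ≤ 2),
    Real.sqrt_mul ha0.le]
  have hs2 : (0 : ℝ) < √2 := by positivity
  have hra := Real.sqrt_pos.2 ha0
  have hrb := Real.sqrt_pos.2 hb0
  have hrn := Real.sqrt_pos.2 hn0
  have he : 0 < Real.exp 1 := Real.exp_pos 1
  have hp : a + b + 1 + 1 = (a + 1) + (b + 1) := by omega
  calc _ = (Stirling.stirlingSeq (a + b + 1 + 1) / (Stirling.stirlingSeq (a + 1)
          * Stirling.stirlingSeq (b + 1)))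
          * (√((a : ℝ) + b + 2) / (√2 * (√((a : ℝ) + 1) * √((b : ℝ) + 1)))) := by
        rw [div_pow, div_pow, div_pow, div_pow, div_pow, hp, pow_add, pow_add]
        field_simp
        ring
    _ ≤ (1 / √Real.pi) * (√((a : ℝ) + b + 2) / (√2 * (√((a : ℝ) + 1) * √((b : ℝ) + 1)))) := by
        refine mul_le_mul_of_nonneg_right ?_ (by positivity)
        rw [div_le_div_iff₀ (by positivity) hspi, one_mul]
        exact mul_le_mul hanti hpi hspi.le hsa.le
    _ = _ := by field_simp

/-- The maximum-likelihood normalizing constant of the binomial model. -/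
noncomputable def binomialMLSum (n : ℕ) : ℝ :=
  ∑ k ∈ Finset.range (n + 1), (n.choose k : ℝ) * (((k : ℝ) / n) ^ k * (1 - (k : ℝ) / n) ^ (n - k))

theorem binomialMLSum_le_of_large {n : ℕ} (hn : 9 ≤ n) : binomialMLSum n ≤ 2 * √(n : ℝ) := by
  obtain ⟨m, rfl⟩ : ∃ m, n = m + 2 := ⟨n - 2, by omega⟩
  have hm : (9 : ℝ) ≤ (m : ℝ) + 2 := by exact_mod_cast hn
  unfold binomialMLSum
  -- The end terms k = n and k = 0, where 1/√(k(n - k)) degenerates, are split off; each equals 1.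
  rw [Finset.sum_range_succ, Finset.sum_range_succ']
  have hn0 : ((m + 2 : ℕ) : ℝ) ≠ 0 := by positivity
  have hterm : ∀ k ∈ Finset.range (m + 1),
      ((m + 2).choose (k + 1) : ℝ) * ((((k + 1 : ℕ) : ℝ) / (m + 2 : ℕ)) ^ (k + 1)
        * (1 - ((k + 1 : ℕ) : ℝ) / (m + 2 : ℕ)) ^ (m + 2 - (k + 1)))
      ≤ 1 / √(2 * Real.pi) * (1 / √((k : ℝ) + 1) + 1 / √(((m - k : ℕ) : ℝ) + 1)) := by
    intro k hk
    obtain ⟨b, rfl⟩ : ∃ b, m = k + b := ⟨m - k, by have := Finset.mem_range.1 hk; omega⟩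
    have h1 := choose_mul_pow_le k b
    have h2 := one_div_sqrt_mul_le (a := (k : ℝ) + 1) (b := (b : ℝ) + 1) (n := (k : ℝ) + b + 2)
      (by positivity) (by positivity) (by ring)
    have hs : 0 < √((k : ℝ) + b + 2) := by positivity
    have hpi : 0 < √(2 * Real.pi) := Real.sqrt_pos.2 (by positivity)
    have e : k + b + 2 - (k + 1) = b + 1 := by omega
    have e' : k + b - k = b := by omega
    rw [e, e']
    have e3 : 1 - ((k + 1 : ℕ) : ℝ) / ((k + b + 2 : ℕ) : ℝ) = ((b : ℝ) + 1) / (k + b + 2) := by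
      push_cast
      field_simp
      ring
    rw [e3, ← mul_assoc]
    push_cast
    refine h1.trans ?_
    calc _ ≤ √((k : ℝ) + b + 2) / √(2 * Real.pi) * ((1 / √((k : ℝ) + b + 2))
          * (1 / √((k : ℝ) + 1) + 1 / √((b : ℝ) + 1))) := by gcongr
      _ = _ := by field_simp
  have hsum := Finset.sum_le_sum hterm
  rw [← Finset.mul_sum, Finset.sum_add_distrib] at hsum
  have hrefl : ∑ k ∈ Finset.range (m + 1), 1 / √(((m - k : ℕ) : ℝ) + 1)
      = ∑ k ∈ Finset.range (m + 1), 1 / √((k : ℝ) + 1) := by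
    have := Finset.sum_range_reflect (fun k : ℕ => 1 / √((k : ℝ) + 1)) (m + 1)
    simpa using this
  rw [hrefl] at hsum
  have hS := sum_one_div_sqrt_le m
  have hmono : √((m : ℝ) + 1) ≤ √((m : ℝ) + 2) := Real.sqrt_le_sqrt (by linarith)
  have hpi : (5 / 2 : ℝ) ≤ √(2 * Real.pi) := by
    apply Real.le_sqrt_of_sq_le
    nlinarith [Real.pi_gt_d2]
  have h3 : 3 ≤ √((m : ℝ) + 2) := by
    apply Real.le_sqrt_of_sq_le
    linarith
  -- With √(2π) ≥ 5/2 the whole sum is at most 2 + (2/5)(4√n - 2), which is below 2√n exactly when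
  -- √n ≥ 3; hence the threshold 9.
  have hbound : 1 / √(2 * Real.pi) * (∑ k ∈ Finset.range (m + 1), 1 / √((k : ℝ) + 1)
      + ∑ k ∈ Finset.range (m + 1), 1 / √((k : ℝ) + 1)) ≤ 2 / 5 * (4 * √((m : ℝ) + 2) - 2) := by
    have h25 : 1 / √(2 * Real.pi) ≤ 2 / 5 := by
      rw [div_le_iff₀ (by linarith)]
      linarith
    have : 0 ≤ ∑ k ∈ Finset.range (m + 1), 1 / √((k : ℝ) + 1) :=
      Finset.sum_nonneg fun _ _ => by positivity
    exact mul_le_mul h25 (by linarith) (by linarith) (by norm_num)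
  have hend : ((m + 2).choose (m + 2) : ℝ) * ((((m + 2 : ℕ) : ℝ) / (m + 2 : ℕ)) ^ (m + 2)
        * (1 - ((m + 2 : ℕ) : ℝ) / (m + 2 : ℕ)) ^ (m + 2 - (m + 2))) = 1 := by
    rw [div_self hn0]; simp
  have hzero : ((m + 2).choose 0 : ℝ) * ((((0 : ℕ) : ℝ) / (m + 2 : ℕ)) ^ 0
        * (1 - ((0 : ℕ) : ℝ) / (m + 2 : ℕ)) ^ (m + 2 - 0)) = 1 := by simp
  rw [hend, hzero]
  have hcast : ((m + 2 : ℕ) : ℝ) = (m : ℝ) + 2 := by push_cast; ring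
  refine (add_le_add_left (add_le_add_left (hsum.trans hbound) _) _).trans ?_
  rw [hcast]
  linarith

theorem binomialMLSum_le {n : ℕ} (hn : 0 < n) : binomialMLSum n ≤ 2 * √(n : ℝ) := by
  rcases le_or_gt 9 n with h9 | h9
  · exact binomialMLSum_le_of_large h9
  -- After squaring, each of the eight small cases is rational arithmetic.
  have : binomialMLSum n / 2 ≤ √(n : ℝ) := by
    apply Real.le_sqrt_of_sq_le
    unfold binomialMLSum
    interval_cases n <;> norm_num [Finset.sum_range_succ, Nat.choose]
  linarith

/-! ### Pinsker's inequality for Bernoulli distributions. -/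

/-- The derivative is minus an exponential times the square (1 - 2p)². This is the boundary case of
Pinsker's inequality, with empirical frequency 0. -/
theorem one_sub_mul_exp_le (p : ℝ) (hp : 0 ≤ p) : (1 - p) * Real.exp (2 * p ^ 2) ≤ 1 := by
  have hd : ∀ x : ℝ, HasDerivAt (fun x : ℝ => (1 - x) * Real.exp (2 * x ^ 2))
      (-(Real.exp (2 * x ^ 2) * (1 - 2 * x) ^ 2)) x := by
    intro x
    have h1 : HasDerivAt (fun x : ℝ => 1 - x) (-1) x := by
      simpa using (hasDerivAt_id x).const_sub 1
    have h2 : HasDerivAt (fun x : ℝ => Real.exp (2 * x ^ 2)) (Real.exp (2 * x ^ 2) * (2 * (2 * x)))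
        x := by
      have := ((hasDerivAt_pow 2 x).const_mul 2).exp
      simpa using this
    exact (h1.mul h2).congr_deriv (by ring)
  have hanti : Antitone (fun x : ℝ => (1 - x) * Real.exp (2 * x ^ 2)) := by
    apply antitone_of_deriv_nonpos (fun x => (hd x).differentiableAt)
    intro x
    rw [(hd x).deriv]
    have := mul_nonneg (Real.exp_pos (2 * x ^ 2)).le (sq_nonneg (1 - 2 * x))
    linarith
  simpa using hanti hp

/-- With a = (k+1)/n, the logarithmic derivative of the left side in p is n(a - p)(1 - 2p)² / (p(1 -
p)). So the maximum over [0, 1] is at p = a, where the exponential is 1. -/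
theorem pow_mul_pow_mul_exp_le_of_pos (k m : ℕ) {p : ℝ} (hp0 : 0 ≤ p) (hp1 : p ≤ 1) :
    p ^ (k + 1) * (1 - p) ^ (m + 1)
        * Real.exp (2 * ((k : ℝ) + m + 2) * (p - (k + 1) / (k + m + 2)) ^ 2)
      ≤ (((k : ℝ) + 1) / (k + m + 2)) ^ (k + 1) * (1 - ((k : ℝ) + 1) / (k + m + 2)) ^ (m + 1) := by
  set n : ℝ := (k : ℝ) + m + 2 with hn
  set a : ℝ := ((k : ℝ) + 1) / n with ha
  have hn0 : 0 < n := by positivity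
  have hna : n * a = k + 1 := by rw [ha]; field_simp
  have ha0 : 0 ≤ a := by positivity
  have ha1 : a ≤ 1 := by rw [ha, div_le_one hn0]; linarith [(Nat.cast_nonneg m : (0 : ℝ) ≤ m)]
  let G : ℝ → ℝ := fun x => x ^ (k + 1) * (1 - x) ^ (m + 1) * Real.exp (2 * n * (x - a) ^ 2)
  have hd : ∀ x : ℝ, HasDerivAt G
      (x ^ k * (1 - x) ^ m * Real.exp (2 * n * (x - a) ^ 2) * (n * (1 - 2 * x) ^ 2) * (a - x)) x := by
    intro x
    have h1 : HasDerivAt (fun x : ℝ => 1 - x) (-1) x := by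
      simpa using (hasDerivAt_id x).const_sub 1
    have h2 := hasDerivAt_pow (k + 1) x
    have h3 := h1.pow (m + 1)
    have h4 : HasDerivAt (fun x : ℝ => x - a) 1 x := (hasDerivAt_id x).sub_const a
    have h5 := ((h4.pow 2).const_mul (2 * n)).exp
    refine ((h2.mul h3).mul h5).congr_deriv ?_
    have hm : (m : ℝ) + 1 = n * (1 - a) := by rw [mul_sub, hna, hn]; ring
    simp only [Nat.add_sub_cancel, Nat.cast_add, Nat.cast_one, Nat.cast_ofNat, Pi.mul_apply,
      Pi.pow_apply]
    rw [hm, ← hna]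
    ring
  have hcont : Continuous G := by fun_prop
  have hGa : G a = a ^ (k + 1) * (1 - a) ^ (m + 1) := by simp [G]
  rw [← hGa]
  change G p ≤ G a
  have hfac : ∀ x : ℝ, 0 ≤ x → x ≤ 1 →
      0 ≤ x ^ k * (1 - x) ^ m * Real.exp (2 * n * (x - a) ^ 2) * (n * (1 - 2 * x) ^ 2) := by
    intro x h0 h1
    have : 0 ≤ 1 - x := by linarith
    positivity
  rcases le_total p a with hpa | hpa
  · have hmono : MonotoneOn G (Set.Icc 0 a) := by
      apply monotoneOn_of_deriv_nonneg (convex_Icc 0 a) hcont.continuousOn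
        (fun x _ => (hd x).differentiableAt.differentiableWithinAt)
      intro x hx
      rw [interior_Icc] at hx
      rw [(hd x).deriv]
      exact mul_nonneg (hfac x hx.1.le (hx.2.le.trans ha1)) (by linarith [hx.2])
    exact hmono ⟨hp0, hpa⟩ ⟨ha0, le_rfl⟩ hpa
  · have hanti : AntitoneOn G (Set.Icc a 1) := by
      apply antitoneOn_of_deriv_nonpos (convex_Icc a 1) hcont.continuousOn
        (fun x _ => (hd x).differentiableAt.differentiableWithinAt)
      intro x hx
      rw [interior_Icc] at hx
      rw [(hd x).deriv]
      exact mul_nonpos_of_nonneg_of_nonpos (hfac x (ha0.trans hx.1.le) hx.2.le) (by linarith [hx.1])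
    exact hanti ⟨le_rfl, ha1⟩ ⟨hpa, hp1⟩ hpa

/-- Pinsker's inequality for Bernoulli distributions, in multiplicative form. -/
theorem pow_mul_pow_mul_exp_le {n k : ℕ} (hn : 0 < n) (hk : k ≤ n) {p : ℝ} (hp0 : 0 ≤ p)
    (hp1 : p ≤ 1) :
    p ^ k * (1 - p) ^ (n - k) * Real.exp (2 * n * (p - k / n) ^ 2)
      ≤ ((k : ℝ) / n) ^ k * (1 - (k : ℝ) / n) ^ (n - k) := by
  have hn0 : (n : ℝ) ≠ 0 := by positivity
  -- The frequencies 0 and 1 come from powers of `one_sub_mul_exp_le`; otherwise both exponents are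
  -- positive.
  rcases Nat.eq_zero_or_pos k with rfl | hk0
  · have h1 := one_sub_mul_exp_le p hp0
    have h2 : 0 ≤ (1 - p) * Real.exp (2 * p ^ 2) := mul_nonneg (by linarith) (Real.exp_pos _).le
    have h3 := pow_le_one₀ (n := n) h2 h1
    rw [mul_pow, ← Real.exp_nat_mul] at h3
    simp only [pow_zero, one_mul, Nat.sub_zero, Nat.cast_zero, zero_div, sub_zero, one_pow]
    rwa [show 2 * (n : ℝ) * p ^ 2 = n * (2 * p ^ 2) by ring]
  rcases Nat.eq_or_lt_of_le hk with rfl | hkn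
  · have h1 := one_sub_mul_exp_le (1 - p) (by linarith)
    rw [sub_sub_cancel] at h1
    have h2 : 0 ≤ p * Real.exp (2 * (1 - p) ^ 2) := mul_nonneg hp0 (Real.exp_pos _).le
    have h3 := pow_le_one₀ (n := k) h2 h1
    rw [mul_pow, ← Real.exp_nat_mul] at h3
    simp only [Nat.sub_self, pow_zero, mul_one, div_self hn0, one_pow]
    rwa [show 2 * (k : ℝ) * (p - 1) ^ 2 = k * (2 * (1 - p) ^ 2) by ring]
  obtain ⟨a, rfl⟩ : ∃ a, k = a + 1 := ⟨k - 1, by omega⟩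
  obtain ⟨b, rfl⟩ : ∃ b, n = a + b + 2 := ⟨n - a - 2, by omega⟩
  have e : a + b + 2 - (a + 1) = b + 1 := by omega
  rw [e]
  push_cast
  exact pow_mul_pow_mul_exp_le_of_pos a b hp0 hp1

/-- Pinsker trades the exponential for the replacement of p by k/n, which leaves a sum free of p. -/
theorem sum_binomial_mul_exp_le {n : ℕ} (hn : 0 < n) {p : ℝ} (hp0 : 0 ≤ p) (hp1 : p ≤ 1) :
    ∑ k ∈ Finset.range (n + 1),
        (n.choose k : ℝ) * (p ^ k * (1 - p) ^ (n - k) * Real.exp (2 * n * (p - k / n) ^ 2))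
      ≤ 2 * √(n : ℝ) := by
  refine le_trans (Finset.sum_le_sum fun k hk => ?_) (binomialMLSum_le hn)
  exact mul_le_mul_of_nonneg_left
    (pow_mul_pow_mul_exp_le hn (by have := Finset.mem_range.1 hk; omega) hp0 hp1) (by positivity)

/-! ### Exponential moments of averages of bounded variables. -/

/-- A convex function of a sum of numbers in `[0, 1]` is at most its multi-affine interpolation
between the vertices of the cube. -/
theorem le_sum_powerset_of_convexOn {ι : Type*} [DecidableEq ι] {F : ℝ → ℝ}
    (hF : ConvexOn ℝ Set.univ F) {x : ι → ℝ} (s : Finset ι) (h0 : ∀ i ∈ s, 0 ≤ x i)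
    (h1 : ∀ i ∈ s, x i ≤ 1) (a : ℝ) :
    F (a + ∑ i ∈ s, x i)
      ≤ ∑ A ∈ s.powerset, (∏ i ∈ A, x i) * (∏ i ∈ s \ A, (1 - x i)) * F (a + A.card) := by
  -- Each coordinate is moved to 0 or 1 along a chord; moving it to 1 calls the induction hypothesis
  -- at `a + 1`.
  induction s using Finset.induction_on generalizing a with
  | empty => simp
  | insert j s hj ih =>
    have hx0 : 0 ≤ x j := h0 j (Finset.mem_insert_self j s)
    have hx1 : x j ≤ 1 := h1 j (Finset.mem_insert_self j s)
    have h0' : ∀ i ∈ s, 0 ≤ x i := fun i hi => h0 i (Finset.mem_insert_of_mem hi)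
    have h1' : ∀ i ∈ s, x i ≤ 1 := fun i hi => h1 i (Finset.mem_insert_of_mem hi)
    rw [Finset.sum_insert hj, Finset.sum_powerset_insert hj]
    have hconv : F (a + (x j + ∑ i ∈ s, x i))
        ≤ (1 - x j) * F (a + ∑ i ∈ s, x i) + x j * F (a + 1 + ∑ i ∈ s, x i) := by
      have := hF.2 (Set.mem_univ (a + ∑ i ∈ s, x i)) (Set.mem_univ (a + 1 + ∑ i ∈ s, x i))
        (by linarith : 0 ≤ 1 - x j) hx0 (by ring)
      simp only [smul_eq_mul] at this
      rwa [show (1 - x j) * (a + ∑ i ∈ s, x i) + x j * (a + 1 + ∑ i ∈ s, x i)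
        = a + (x j + ∑ i ∈ s, x i) by ring] at this
    refine hconv.trans (add_le_add ?_ ?_)
    · refine (mul_le_mul_of_nonneg_left (ih h0' h1' a) (by linarith)).trans_eq ?_
      rw [Finset.mul_sum]
      refine Finset.sum_congr rfl fun A hA => ?_
      have hjA : j ∉ A := fun h => hj (Finset.mem_powerset.1 hA h)
      rw [Finset.insert_sdiff_of_notMem _ hjA, Finset.prod_insert (by simp [hj])]
      ring
    · refine (mul_le_mul_of_nonneg_left (ih h0' h1' (a + 1)) hx0).trans_eq ?_
      rw [Finset.mul_sum]
      refine Finset.sum_congr rfl fun A hA => ?_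
      have hjA : j ∉ A := fun h => hj (Finset.mem_powerset.1 hA h)
      have hsd : insert j s \ insert j A = s \ A := by
        ext i
        simp only [Finset.mem_sdiff, Finset.mem_insert]
        by_cases hij : i = j
        · subst hij; simp [hj]
        · simp [hij]
      rw [hsd, Finset.prod_insert hjA, Finset.card_insert_of_notMem hjA]
      push_cast
      rw [show a + 1 + (A.card : ℝ) = a + (A.card + 1) by ring]
      ring

theorem convexOn_exp_sq (n p : ℝ) (hn : 0 < n) :
    ConvexOn ℝ Set.univ fun t : ℝ => Real.exp (2 * n * (p - t / n) ^ 2) := by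
  have hsq : ConvexOn ℝ Set.univ fun t : ℝ => 2 * n * (p - t / n) ^ 2 := by
    refine ⟨convex_univ, fun x _ y _ a b ha hb hab => ?_⟩
    simp only [smul_eq_mul]
    obtain rfl : b = 1 - a := by linarith
    have h1 : 0 ≤ 2 * n * (a * (1 - a) * (x / n - y / n) ^ 2) := by positivity
    have h2 : (a * x + (1 - a) * y) / n = a * (x / n) + (1 - a) * (y / n) := by ring
    rw [h2]
    nlinarith [h1]
  refine ⟨convex_univ, fun x hx y hy a b ha hb hab => ?_⟩
  exact (Real.exp_le_exp.2 (hsq.2 hx hy ha hb hab)).trans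
    (convexOn_exp.2 (Set.mem_univ _) (Set.mem_univ _) ha hb hab)

/-- The exponential moment bound behind the PAC-Bayes theorem. -/
theorem lintegral_exp_sq_le {Z : Type*} [MeasurableSpace Z] (𝒟 : Measure Z)
    [IsProbabilityMeasure 𝒟] {X : Z → ℝ} (hX : Measurable X) (hX01 : ∀ z, X z ∈ Set.Icc (0 : ℝ) 1)
    {n : ℕ} (hn : 0 < n) :
    ∫⁻ s : Fin n → Z, ENNReal.ofReal (Real.exp (2 * n * (∫ z, X z ∂𝒟 - (∑ j, X (s j)) / n) ^ 2))
        ∂(Measure.pi fun _ => 𝒟) ≤ ENNReal.ofReal (2 * √(n : ℝ)) := by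
  set p : ℝ := ∫ z, X z ∂𝒟 with hp
  have hXint : Integrable X 𝒟 :=
    Integrable.of_bound hX.aestronglyMeasurable 1 (ae_of_all _ fun z => by
      rw [Real.norm_eq_abs, abs_le]; exact ⟨by linarith [(hX01 z).1], (hX01 z).2⟩)
  have hp0 : 0 ≤ p := integral_nonneg fun z => (hX01 z).1
  have hp1 : p ≤ 1 := by
    have := integral_mono hXint (integrable_const (1 : ℝ)) fun z => (hX01 z).2
    simpa using this
  have hn0 : (0 : ℝ) < n := by exact_mod_cast hn
  set F : ℝ → ℝ := fun t => Real.exp (2 * n * (p - t / n) ^ 2) with hF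
  have hconv : ConvexOn ℝ Set.univ F := convexOn_exp_sq n p hn0
  -- `w A s` is the probability that independent Bernoulli variables with means `X (s i)` equal 1
  -- exactly on `A`. Averaged over `s`, every mean becomes `p`.
  let w : Finset (Fin n) → (Fin n → Z) → ℝ := fun A s =>
    ∏ i, (if i ∈ A then X (s i) else 1 - X (s i))
  have hw : ∀ A s, w A s = (∏ i ∈ A, X (s i)) * ∏ i ∈ Finset.univ \ A, (1 - X (s i)) := by
    intro A s
    simp only [w]
    rw [Finset.prod_ite]
    congr 1
    · congr 1; ext; simp
    · congr 1; ext; simp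
  have hpt : ∀ s : Fin n → Z, F (∑ j, X (s j))
      ≤ ∑ A ∈ (Finset.univ : Finset (Fin n)).powerset, w A s * F A.card := by
    intro s
    have := le_sum_powerset_of_convexOn hconv (x := fun j => X (s j)) Finset.univ
      (fun i _ => (hX01 _).1) (fun i _ => (hX01 _).2) 0
    simpa only [zero_add, hw] using this
  have hfac : ∀ (A : Finset (Fin n)) (i : Fin n),
      Integrable (fun z => if i ∈ A then X z else 1 - X z) 𝒟 := by
    intro A i
    split_ifs
    · exact hXint
    · exact (integrable_const 1).sub hXint
  have hwint : ∀ A, Integrable (w A) (Measure.pi fun _ => 𝒟) := fun A =>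
    Integrable.fintype_prod (f := fun i z => if i ∈ A then X z else 1 - X z) (hfac A)
  have hwval : ∀ A : Finset (Fin n), ∫ s, w A s ∂(Measure.pi fun _ => 𝒟)
      = p ^ A.card * (1 - p) ^ (n - A.card) := by
    intro A
    simp only [w]
    rw [integral_fintype_prod_eq_prod (fun i z => if i ∈ A then X z else 1 - X z)]
    have : ∀ i, ∫ z, (if i ∈ A then X z else 1 - X z) ∂𝒟 = if i ∈ A then p else 1 - p := by
      intro i
      split_ifs
      · rfl
      · rw [integral_sub (integrable_const 1) hXint]; simp [hp]
    simp_rw [this]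
    rw [Finset.prod_ite, Finset.prod_const, Finset.prod_const]
    have e1 : (Finset.univ.filter fun i => i ∈ A) = A := by ext; simp
    have e2 : (Finset.univ.filter fun i => i ∉ A) = Aᶜ := by ext; simp
    rw [e1, e2, Finset.card_compl, Fintype.card_fin]
  have hsumint : Integrable (fun s => ∑ A ∈ (Finset.univ : Finset (Fin n)).powerset,
      w A s * F A.card) (Measure.pi fun _ => 𝒟) :=
    integrable_finsetSum _ fun A _ => (hwint A).mul_const _
  calc _ ≤ ∫⁻ s : Fin n → Z, ENNReal.ofReal (∑ A ∈ (Finset.univ : Finset (Fin n)).powerset,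
        w A s * F A.card) ∂(Measure.pi fun _ => 𝒟) :=
        lintegral_mono fun s => ENNReal.ofReal_le_ofReal (hpt s)
    _ = ENNReal.ofReal (∫ s : Fin n → Z, ∑ A ∈ (Finset.univ : Finset (Fin n)).powerset,
        w A s * F A.card ∂(Measure.pi fun _ => 𝒟)) := by
        rw [ofReal_integral_eq_lintegral_ofReal hsumint]
        exact ae_of_all _ fun s => (Real.exp_pos _).le.trans (hpt s)
    _ ≤ _ := by
        refine ENNReal.ofReal_le_ofReal (le_trans (le_of_eq ?_) (sum_binomial_mul_exp_le hn hp0 hp1))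
        rw [integral_finsetSum _ fun A _ => (hwint A).mul_const _]
        simp_rw [integral_mul_const, hwval]
        rw [Finset.sum_powerset_apply_card
          (fun k => p ^ k * (1 - p) ^ (n - k) * F k)]
        simp only [Finset.card_univ, Fintype.card_fin, nsmul_eq_mul, hF]

/-! ### Change of measure and Kullback–Leibler divergence. -/

/-- The Donsker–Varadhan inequality. -/
theorem integral_le_klDiv_add_log {Ω : Type*} [MeasurableSpace Ω] {μ ν : Measure Ω}
    [IsProbabilityMeasure μ] [IsProbabilityMeasure ν] (hkl : klDiv μ ν ≠ ∞) {φ : Ω → ℝ}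
    (hφμ : Integrable φ μ) (hφν : Integrable (fun x => Real.exp (φ x)) ν) :
    ∫ x, φ x ∂μ ≤ (klDiv μ ν).toReal + Real.log (∫ x, Real.exp (φ x) ∂ν) := by
  obtain ⟨hac, hint⟩ := klDiv_ne_top_iff.1 hkl
  -- The inequality is the nonnegativity of the divergence of `μ` from the Gibbs measure `ν.tilted
  -- φ`.
  have : IsProbabilityMeasure (ν.tilted φ) := isProbabilityMeasure_tilted hφν
  have hac' : μ ≪ ν.tilted φ := hac.trans (absolutelyContinuous_tilted hφν)
  have h1 := integral_llr_tilted_right hac hφμ hφν hint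
  have h2 := integral_llr_add_sub_measure_univ_nonneg hac'
    (integrable_llr_tilted_right hac hφμ hint hφν)
  rw [toReal_klDiv_of_measure_eq hac (by simp)]
  simp only [probReal_univ, add_sub_cancel_right] at h2
  linarith

/-- Data processing, applied along `e` and along its inverse. -/
theorem klDiv_map_measurableEquiv {X Y : Type*} [MeasurableSpace X] [MeasurableSpace Y]
    (e : X ≃ᵐ Y) (μ ν : Measure X) [IsFiniteMeasure μ] [IsFiniteMeasure ν] :
    klDiv (μ.map e) (ν.map e) = klDiv μ ν := by
  refine le_antisymm (klDiv_map_le _ _ e.measurable) ?_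
  have h := klDiv_map_le (μ.map e) (ν.map e) e.symm.measurable
  simpa using h

theorem klDiv_withDensity_exp {X : Type*} [MeasurableSpace X] {ν : Measure X}
    [IsProbabilityMeasure ν] {g : X → ℝ} (hg : Measurable g)
    [IsProbabilityMeasure (ν.withDensity fun x => ENNReal.ofReal (Real.exp (g x)))]
    (hint : Integrable g (ν.withDensity fun x => ENNReal.ofReal (Real.exp (g x)))) :
    klDiv (ν.withDensity fun x => ENNReal.ofReal (Real.exp (g x))) ν
      = ENNReal.ofReal (∫ x, g x ∂(ν.withDensity fun x => ENNReal.ofReal (Real.exp (g x)))) := by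
  set μ := ν.withDensity fun x => ENNReal.ofReal (Real.exp (g x)) with hμ
  have hac : μ ≪ ν := withDensity_absolutelyContinuous _ _
  have hm : Measurable fun x => ENNReal.ofReal (Real.exp (g x)) := by fun_prop
  have hllr : llr μ ν =ᵐ[μ] g := by
    filter_upwards [hac.ae_le (Measure.rnDeriv_withDensity ν hm)] with x hx
    rw [llr, hx, ENNReal.toReal_ofReal (Real.exp_pos _).le, Real.log_exp]
  have hint' : Integrable (llr μ ν) μ := (integrable_congr hllr).2 hint
  rw [klDiv_of_ac_of_integrable hac hint', integral_congr_ae hllr]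
  simp

theorem pi_withDensity_exp {ι : Type*} [Fintype ι] {X : ι → Type*} [∀ i, MeasurableSpace (X i)]
    (ν : ∀ i, Measure (X i)) [∀ i, IsProbabilityMeasure (ν i)] {g : ∀ i, X i → ℝ}
    (hg : ∀ i, Measurable (g i))
    [∀ i, IsProbabilityMeasure ((ν i).withDensity fun x => ENNReal.ofReal (Real.exp (g i x)))] :
    Measure.pi (fun i => (ν i).withDensity fun x => ENNReal.ofReal (Real.exp (g i x)))
      = (Measure.pi ν).withDensity fun x => ENNReal.ofReal (Real.exp (∑ i, g i (x i))) := by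
  have hint : ∀ i, Integrable (fun x => Real.exp (g i x)) (ν i) := by
    intro i
    refine ⟨(by fun_prop), ?_⟩
    rw [hasFiniteIntegral_iff_ofReal (ae_of_all _ fun x => (Real.exp_pos _).le)]
    have := measure_lt_top ((ν i).withDensity fun x => ENNReal.ofReal (Real.exp (g i x))) Set.univ
    rwa [withDensity_apply _ MeasurableSet.univ, Measure.restrict_univ] at this
  refine Measure.pi_eq fun s hs => ?_
  rw [withDensity_apply _ (MeasurableSet.univ_pi hs), Measure.restrict_pi_pi]
  have hpi : Integrable (fun x : ∀ i, X i => ∏ i, Real.exp (g i (x i)))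
      (Measure.pi fun i => (ν i).restrict (s i)) :=
    Integrable.fintype_prod_dep (f := fun i x => Real.exp (g i x)) fun i => (hint i).restrict
  simp_rw [Real.exp_sum]
  rw [← ofReal_integral_eq_lintegral_ofReal hpi
    (ae_of_all _ fun x => Finset.prod_nonneg fun i _ => (Real.exp_pos _).le),
    integral_fintype_prod_eq_prod (fun i x => Real.exp (g i x)),
    ENNReal.ofReal_prod_of_nonneg fun i _ => integral_nonneg fun x => (Real.exp_pos _).le]
  refine Finset.prod_congr rfl fun i _ => ?_
  rw [withDensity_apply _ (hs i), ofReal_integral_eq_lintegral_ofReal (hint i).restrict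
    (ae_of_all _ fun x => (Real.exp_pos _).le)]

/-! ### Gaussian measures in an orthonormal eigenbasis and their divergence. -/

open scoped NNReal in
-- In an eigenbasis of `S` the quadratic form in the characteristic function becomes a sum of
-- squares, so that function factors over the coordinates.
theorem multivariateGaussian_eq_map_pi {ι : Type*} [Fintype ι] [DecidableEq ι]
    (b : OrthonormalBasis ι ℝ (EuclideanSpace ℝ ι)) {S : Matrix ι ι ℝ} (hS : S.PosSemidef)
    (v : ι → ℝ≥0) (hv : ∀ i, S *ᵥ (b i).ofLp = (v i : ℝ) • (b i).ofLp)
    (m : EuclideanSpace ℝ ι) :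
    multivariateGaussian m S = (Measure.pi fun i => gaussianReal (b.repr m i) (v i)).map
      ((MeasurableEquiv.toLp 2 (ι → ℝ)).trans b.repr.symm.toHomeomorph.toMeasurableEquiv) := by
  have hcoe : ⇑((MeasurableEquiv.toLp 2 (ι → ℝ)).trans
      b.repr.symm.toHomeomorph.toMeasurableEquiv) = b.repr.symm ∘ WithLp.toLp 2 := rfl
  have hbm : Measurable b.repr.symm := b.repr.symm.continuous.measurable
  have htm : Measurable (WithLp.toLp 2 : (ι → ℝ) → EuclideanSpace ℝ ι) :=
    (MeasurableEquiv.toLp 2 (ι → ℝ)).measurable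
  rw [hcoe, ← Measure.map_map hbm htm]
  have : IsProbabilityMeasure ((Measure.map (WithLp.toLp 2)
      (Measure.pi fun i => gaussianReal (b.repr m i) (v i))).map b.repr.symm) := by
    have := Measure.isProbabilityMeasure_map
      (μ := Measure.pi fun i => gaussianReal (b.repr m i) (v i)) htm.aemeasurable
    exact Measure.isProbabilityMeasure_map hbm.aemeasurable
  apply Measure.ext_of_charFun
  ext t
  have hmap : charFun ((Measure.map (WithLp.toLp 2)
      (Measure.pi fun i => gaussianReal (b.repr m i) (v i))).map b.repr.symm) t
      = charFun (Measure.map (WithLp.toLp 2)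
        (Measure.pi fun i => gaussianReal (b.repr m i) (v i))) (b.repr t) := by
    rw [charFun_apply, charFun_apply, integral_map hbm.aemeasurable (by fun_prop)]
    refine integral_congr_ae (ae_of_all _ fun x => ?_)
    have : inner ℝ (b.repr.symm x) t = inner ℝ x (b.repr t) := by
      rw [← b.repr.inner_map_map, LinearIsometryEquiv.apply_symm_apply]
    simp only [this]
  rw [hmap, charFun_pi, charFun_multivariateGaussian hS]
  simp_rw [charFun_gaussianReal, ← Complex.exp_sum]
  congr 1
  have hin : inner ℝ t m = ∑ i, b.repr t i * b.repr m i := by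
    rw [← b.repr.inner_map_map, PiLp.inner_apply]
    simp [mul_comm]
  have hquad : t.ofLp ⬝ᵥ S *ᵥ t.ofLp = ∑ i, (v i : ℝ) * b.repr t i ^ 2 := by
    have ht : t.ofLp = ∑ i, b.repr t i • (b i).ofLp := by
      conv_lhs => rw [← b.sum_repr t]
      simp
    have hSt : S *ᵥ t.ofLp = ∑ i, (b.repr t i * v i) • (b i).ofLp := by
      conv_lhs => rw [ht]
      rw [Matrix.mulVec_sum]
      refine Finset.sum_congr rfl fun i _ => ?_
      rw [Matrix.mulVec_smul, hv, smul_smul]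
    rw [hSt, dotProduct_sum]
    refine Finset.sum_congr rfl fun i _ => ?_
    have hrepr : t.ofLp ⬝ᵥ (b i).ofLp = b.repr t i := by
      rw [b.repr_apply_apply, EuclideanSpace.inner_eq_star_dotProduct]
      simp
    rw [dotProduct_smul, hrepr, smul_eq_mul]
    ring
  rw [hin, hquad]
  push_cast
  rw [Finset.sum_mul, Finset.sum_div, ← Finset.sum_sub_distrib]

section GaussianDivergence

open scoped NNReal

/-- Log-density of `N(m, v)` with respect to `N(0, w)`. -/
noncomputable def gaussianLogRatio (m : ℝ) (v w : ℝ≥0) (x : ℝ) : ℝ :=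
  Real.log (w / v) / 2 - (x - m) ^ 2 / (2 * v) + x ^ 2 / (2 * w)

theorem measurable_gaussianLogRatio (m : ℝ) (v w : ℝ≥0) : Measurable (gaussianLogRatio m v w) := by
  unfold gaussianLogRatio
  fun_prop

theorem gaussianReal_eq_withDensity (m : ℝ) {v w : ℝ≥0} (hv : v ≠ 0) (hw : w ≠ 0) :
    gaussianReal m v = (gaussianReal 0 w).withDensity
      fun x => ENNReal.ofReal (Real.exp (gaussianLogRatio m v w x)) := by
  have hv0 : (0 : ℝ) < v := by positivity
  have hw0 : (0 : ℝ) < w := by positivity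
  rw [gaussianReal_of_var_ne_zero _ hv, gaussianReal_of_var_ne_zero _ hw,
    ← withDensity_mul _ (measurable_gaussianPDF _ _)
      (measurable_gaussianLogRatio m v w).exp.ennreal_ofReal]
  congr 1
  funext x
  rw [Pi.mul_apply, gaussianPDF, gaussianPDF, ← ENNReal.ofReal_mul (gaussianPDFReal_nonneg _ _ _)]
  congr 1
  have hsqrt : Real.exp (Real.log ((w : ℝ) / v) / 2) = √w / √v := by
    rw [← Real.log_sqrt (by positivity), Real.exp_log (by positivity), Real.sqrt_div hw0.le]
  simp only [gaussianPDFReal, gaussianLogRatio]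
  rw [Real.exp_add, Real.exp_sub, hsqrt,
    Real.sqrt_mul (by positivity) (v : ℝ), Real.sqrt_mul (by positivity) (w : ℝ), neg_div, neg_div, Real.exp_neg, Real.exp_neg, sub_zero]
  have := Real.sqrt_pos.2 hv0
  have := Real.sqrt_pos.2 hw0
  field_simp

theorem integrable_sq_gaussianReal (m : ℝ) (v : ℝ≥0) :
    Integrable (fun x : ℝ => x ^ 2) (gaussianReal m v) :=
  (memLp_id_gaussianReal' 2 (by simp)).integrable_sq

theorem integral_sq_gaussianReal (m : ℝ) (v : ℝ≥0) :
    ∫ x, x ^ 2 ∂(gaussianReal m v) = v + m ^ 2 := by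
  have h := variance_eq_sub (memLp_id_gaussianReal' (μ := m) (v := v) 2 (by simp))
  rw [variance_id_gaussianReal] at h
  simp only [Pi.pow_apply, id_eq, integral_id_gaussianReal] at h
  linarith

/-- As a quadratic polynomial, the log-density is integrated from the first two moments alone. -/
theorem gaussianLogRatio_eq (m : ℝ) (v w : ℝ≥0) :
    gaussianLogRatio m v w = fun x => (Real.log (w / v) / 2 - m ^ 2 / (2 * v))
      + (m / v) * x + (1 / (2 * w) - 1 / (2 * v)) * x ^ 2 := by
  funext x
  simp only [gaussianLogRatio]
  ring

theorem integrable_gaussianLogRatio (m : ℝ) (v w : ℝ≥0) :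
    Integrable (gaussianLogRatio m v w) (gaussianReal m v) := by
  have h1 : Integrable (fun x : ℝ => x) (gaussianReal m v) :=
    (memLp_id_gaussianReal' 1 (by simp)).integrable le_rfl
  rw [gaussianLogRatio_eq]
  exact ((integrable_const _).add (h1.const_mul _)).add
    ((integrable_sq_gaussianReal m v).const_mul _)

theorem integral_gaussianLogRatio (m : ℝ) {v w : ℝ≥0} (hv : v ≠ 0) :
    ∫ x, gaussianLogRatio m v w x ∂(gaussianReal m v)
      = m ^ 2 / (2 * w) + h (v / w) / 2 := by
  have h1 : Integrable (fun x : ℝ => x) (gaussianReal m v) :=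
    (memLp_id_gaussianReal' 1 (by simp)).integrable le_rfl
  have hv0 : (v : ℝ) ≠ 0 := by exact_mod_cast hv
  simp only [gaussianLogRatio_eq]
  have h2 : Integrable (fun x : ℝ => (Real.log (w / v) / 2 - m ^ 2 / (2 * v)) + (m / v) * x)
      (gaussianReal m v) := (integrable_const _).add (h1.const_mul _)
  rw [integral_add h2 ((integrable_sq_gaussianReal m v).const_mul _),
    integral_add (integrable_const _) (h1.const_mul _), integral_const_mul, integral_const_mul, integral_sq_gaussianReal,
    integral_id_gaussianReal, integral_const]
  simp only [probReal_univ, smul_eq_mul, one_mul, h]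
  rw [← inv_div (v : ℝ) w, Real.log_inv]
  have hmv : m ^ 2 / (2 * (v : ℝ)) = m / v * m / 2 := by field_simp
  have hvv : 1 / (2 * (v : ℝ)) * v = 1 / 2 := by field_simp
  have hvm : 1 / (2 * (v : ℝ)) * m ^ 2 = m / v * m / 2 := by field_simp
  rw [hmv, sub_mul, mul_add (1 / (2 * (v : ℝ))), hvv, hvm]
  ring

/-- Densities of product measures multiply, so log-densities add and each is integrated in its own
coordinate. -/
theorem klDiv_pi_gaussianReal {ι : Type*} [Fintype ι] (m : ι → ℝ) {v : ι → ℝ≥0} {w : ℝ≥0}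
    (hv : ∀ i, v i ≠ 0) (hw : w ≠ 0) :
    klDiv (Measure.pi fun i => gaussianReal (m i) (v i)) (Measure.pi fun _ => gaussianReal 0 w)
      = ENNReal.ofReal (∑ i, (m i ^ 2 / (2 * w) + h (v i / w) / 2)) := by
  have hg : ∀ i, Measurable (gaussianLogRatio (m i) (v i) w) := fun i =>
    measurable_gaussianLogRatio _ _ _
  have hden : ∀ i, (gaussianReal 0 w).withDensity
      (fun x => ENNReal.ofReal (Real.exp (gaussianLogRatio (m i) (v i) w x)))
      = gaussianReal (m i) (v i) := fun i => (gaussianReal_eq_withDensity _ (hv i) hw).symm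
  have : ∀ i, IsProbabilityMeasure ((gaussianReal 0 w).withDensity
      (fun x => ENNReal.ofReal (Real.exp (gaussianLogRatio (m i) (v i) w x)))) := by
    intro i
    rw [hden]
    infer_instance
  have hpi := pi_withDensity_exp (fun _ : ι => gaussianReal 0 w) hg
  simp_rw [hden] at hpi
  have hcomp : ∀ i, Integrable (fun x : ι → ℝ => gaussianLogRatio (m i) (v i) w (x i))
      (Measure.pi fun i => gaussianReal (m i) (v i)) := fun i =>
    integrable_comp_eval (integrable_gaussianLogRatio (m i) (v i) w)
  have hint : Integrable (fun x : ι → ℝ => ∑ i, gaussianLogRatio (m i) (v i) w (x i))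
      (Measure.pi fun i => gaussianReal (m i) (v i)) := integrable_finsetSum _ fun i _ => hcomp i
  have hval : ∫ x : ι → ℝ, ∑ i, gaussianLogRatio (m i) (v i) w (x i)
      ∂(Measure.pi fun i => gaussianReal (m i) (v i))
      = ∑ i, (m i ^ 2 / (2 * w) + h (v i / w) / 2) := by
    rw [integral_finsetSum _ fun i _ => hcomp i]
    refine Finset.sum_congr rfl fun i _ => ?_
    rw [integral_comp_eval (μ := fun i => gaussianReal (m i) (v i)) (i := i)
      (hg i).aestronglyMeasurable, integral_gaussianLogRatio _ (hv i)]
  rw [← hval]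
  have hprob : IsProbabilityMeasure (Measure.pi fun i => gaussianReal (m i) (v i)) := inferInstance
  rw [hpi] at hint hprob ⊢
  exact klDiv_withDensity_exp (by fun_prop) hint

/-! ### Divergence of the regression posterior from the prior. -/

section Posterior

variable {ι : Type*} [Fintype ι] {D P K : ℕ} (f : Vec D → Vec P → Vec K) (z : ι → Example D K)
  (θ : Vec P) {α σ : ℝ}

theorem sharpnessMatrix_posDef : (sharpnessMatrix f z θ α σ).PosDef := by
  unfold sharpnessMatrix
  refine Matrix.PosDef.inv (Matrix.PosDef.one.add_posSemidef ?_)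
  have := Matrix.posSemidef_conjTranspose_mul_self (connJacobian f z θ)
  rw [Matrix.conjTranspose_eq_transpose_of_trivial] at this
  exact this.smul (by positivity)

theorem postCov_eq_smul (hα : 0 < α) :
    postCov f z θ α σ = α ^ 2 • sharpnessMatrix f z θ α σ := by
  unfold postCov sharpnessMatrix
  have hα2 : α ^ 2 ≠ 0 := by positivity
  set J := (connJacobian f z θ)ᵀ * connJacobian f z θ
  have hdet : IsUnit (1 + (α ^ 2 / σ ^ 2) • J).det := by
    have := (sharpnessMatrix_posDef f z θ (α := α) (σ := σ)).isUnit
    rw [sharpnessMatrix, Matrix.isUnit_nonsing_inv_iff] at this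
    exact (Matrix.isUnit_iff_isUnit_det _).1 this
  have e : (1 / α ^ 2) • (1 : Matrix (Fin P) (Fin P) ℝ) + (1 / σ ^ 2) • J
      = (α ^ 2)⁻¹ • (1 + (α ^ 2 / σ ^ 2) • J) := by
    rw [smul_add, smul_smul, one_div]
    congr 2
    field_simp
  rw [e]
  apply Matrix.inv_eq_right_inv
  rw [smul_mul_smul_comm, inv_mul_cancel₀ hα2, Matrix.mul_nonsing_inv _ hdet, one_smul]

theorem beta_pos (p : Fin P) : 0 < beta f z θ α σ p :=
  (sharpnessMatrix_posDef f z θ).eigenvalues_pos p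

theorem klDiv_posterior_prior (hα : 0 < α) :
    klDiv (posterior f z θ α σ) (prior P α)
      = ENNReal.ofReal ((∑ p, postMean f z θ α σ p * postMean f z θ α σ p) / (2 * α ^ 2)
        + (∑ p, h (beta f z θ α σ p)) / 2) := by
  have hB := sharpnessMatrix_isHermitian f z θ α σ
  -- The isotropic prior is a product in any orthonormal basis, so an eigenbasis for the posterior
  -- serves both; the common isometry does not affect the divergence.
  set b := hB.eigenvectorBasis with hb
  have hα2 : 0 < α ^ 2 := by positivity
  have hβ := beta_pos f z θ (α := α) (σ := σ)
  let w : ℝ≥0 := ⟨α ^ 2, hα2.le⟩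
  let v : Fin P → ℝ≥0 := fun p => ⟨α ^ 2 * beta f z θ α σ p, (mul_pos hα2 (hβ p)).le⟩
  have hw : w ≠ 0 := by
    rw [← NNReal.coe_ne_zero]; exact hα2.ne'
  have hv : ∀ p, v p ≠ 0 := fun p => by
    rw [← NNReal.coe_ne_zero]; exact (mul_pos hα2 (hβ p)).ne'
  have hpost : posterior f z θ α σ = _ :=
    multivariateGaussian_eq_map_pi b (S := postCov f z θ α σ)
      (by rw [postCov_eq_smul f z θ hα]; exact (sharpnessMatrix_posDef f z θ).posSemidef.smul hα2.le)
      v (fun p => by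
        rw [postCov_eq_smul f z θ hα, Matrix.smul_mulVec, hb, hB.mulVec_eigenvectorBasis, smul_smul]
        rfl)
      (postMean f z θ α σ)
  have hprior : prior P α = _ :=
    multivariateGaussian_eq_map_pi b (S := α ^ 2 • (1 : Matrix (Fin P) (Fin P) ℝ))
      (Matrix.PosSemidef.one.smul hα2.le) (fun _ => w)
      (fun p => by rw [Matrix.smul_mulVec, Matrix.one_mulVec]; rfl) 0
  rw [hpost, hprior, klDiv_map_measurableEquiv]
  simp only [map_zero, PiLp.zero_apply]
  rw [klDiv_pi_gaussianReal _ hv hw]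
  congr 1
  rw [Finset.sum_add_distrib, ← Finset.sum_div, ← Finset.sum_div]
  have hnorm : ∑ p, b.repr (postMean f z θ α σ) p ^ 2
      = ∑ p, postMean f z θ α σ p * postMean f z θ α σ p := by
    have h1 := EuclideanSpace.real_norm_sq_eq (b.repr (postMean f z θ α σ))
    have h2 := EuclideanSpace.real_norm_sq_eq (postMean f z θ α σ)
    rw [← h1, LinearIsometryEquiv.norm_map, h2]
    simp_rw [sq]
  rw [hnorm]
  congr 3
  funext p
  congr 1
  change α ^ 2 * beta f z θ α σ p / α ^ 2 = _
  field_simp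

end Posterior

end GaussianDivergence

/-! ### Invariance under function-preserving diagonal maps. -/

/-- Chain rule for f x ∘ T = f x in the direction of the p-th basis vector, which `T` multiplies by
`t p`. For a continuous linear equivalence it also holds where `fderiv` takes its default value 0.
-/
theorem jacobian_mul_of_comp_eq {D P K : ℕ} {f : Vec D → Vec P → Vec K} {T : Vec P ≃ₗ[ℝ] Vec P}
    {t : Fin P → ℝ} (ht : ∀ ψ p, T ψ p = t p * ψ p) (hT : ∀ x ψ, f x (T ψ) = f x ψ)
    (x : Vec D) (θ : Vec P) (k : Fin K) (p : Fin P) :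
    jacobian f x (T θ) k p * t p = jacobian f x θ k p := by
  have hcomp : f x ∘ T.toContinuousLinearEquiv = f x := funext (hT x)
  have h1 := T.toContinuousLinearEquiv.comp_right_fderiv (f := f x) (x := θ)
  rw [hcomp] at h1
  have hs : T (EuclideanSpace.single p 1) = t p • EuclideanSpace.single p (1 : ℝ) := by
    ext q
    rw [ht]
    by_cases hq : q = p
    · subst hq; simp
    · simp [hq]
  simp only [jacobian, Matrix.of_apply]
  rw [h1]
  simp [hs, mul_comm]

theorem connJacobian_eq_of_comp_eq {ι : Type*} {D P K : ℕ} {f : Vec D → Vec P → Vec K}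
    {T : Vec P ≃ₗ[ℝ] Vec P} (hdiag : IsDiagonal T) (hT : ∀ x ψ, f x (T ψ) = f x ψ)
    (z : ι → Example D K) (θ : Vec P) : connJacobian f z (T θ) = connJacobian f z θ := by
  obtain ⟨t, ht⟩ := hdiag
  ext ik p
  simp only [connJacobian, Matrix.of_apply, Matrix.mul_diagonal]
  rw [← jacobian_mul_of_comp_eq ht hT _ θ, ht, mul_assoc]

theorem perturb_map {P : ℕ} {T : Vec P ≃ₗ[ℝ] Vec P} (hdiag : IsDiagonal T) (θ c : Vec P) :
    perturb (T θ) c = T (perturb θ c) := by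
  obtain ⟨t, ht⟩ := hdiag
  ext p
  simp only [perturb, hadamard, PiLp.add_apply, ht]
  ring

section Invariance

variable {ι : Type*} [Fintype ι] {D P K : ℕ} {f : Vec D → Vec P → Vec K}
  {T : Vec P ≃ₗ[ℝ] Vec P}

theorem postMean_eq_of_comp_eq (hdiag : IsDiagonal T) (hT : ∀ x ψ, f x (T ψ) = f x ψ)
    (z : ι → Example D K) (θ : Vec P) (α σ : ℝ) :
    postMean f z (T θ) α σ = postMean f z θ α σ := by
  have hr : residual f z (T θ) = residual f z θ := by
    funext ik
    rw [residual, residual, hT]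
  simp only [postMean, postCov, hr, connJacobian_eq_of_comp_eq hdiag hT]

theorem posterior_eq_of_comp_eq (hdiag : IsDiagonal T) (hT : ∀ x ψ, f x (T ψ) = f x ψ)
    (z : ι → Example D K) (θ : Vec P) (α σ : ℝ) :
    posterior f z (T θ) α σ = posterior f z θ α σ := by
  simp only [posterior, postMean_eq_of_comp_eq hdiag hT, postCov,
    connJacobian_eq_of_comp_eq hdiag hT]

theorem beta_eq_of_comp_eq (hdiag : IsDiagonal T) (hT : ∀ x ψ, f x (T ψ) = f x ψ)
    (z : ι → Example D K) (θ : Vec P) (α σ : ℝ) : beta f z (T θ) α σ = beta f z θ α σ := by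
  -- `eigenvalues` depends on a proof about its matrix, so the equality is substituted for general
  -- matrices.
  have hcongr : ∀ (A B : Matrix (Fin P) (Fin P) ℝ) (hA : A.IsHermitian) (hB : B.IsHermitian),
      A = B → hA.eigenvalues = hB.eigenvalues := by
    rintro A _ _ _ rfl
    rfl
  apply hcongr
  simp only [sharpnessMatrix, connJacobian_eq_of_comp_eq hdiag hT]

theorem measurable_perturb_uncurry {P : ℕ} :
    Measurable fun w : Vec P × Vec P => perturb w.1 w.2 := by
  unfold perturb hadamard
  fun_prop

theorem paramPosterior_map (hdiag : IsDiagonal T) (hT : ∀ x ψ, f x (T ψ) = f x ψ)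
    (z : ι → Example D K) (θ : Vec P) (α σ : ℝ) :
    paramPosterior f z (T θ) α σ = (paramPosterior f z θ α σ).map T := by
  have hTm : Measurable T := T.toContinuousLinearEquiv.continuous.measurable
  have hp : Measurable (perturb θ) := measurable_perturb_uncurry.comp measurable_prodMk_left
  rw [paramPosterior, paramPosterior, Measure.map_map hTm hp, posterior_eq_of_comp_eq hdiag hT]
  congr 1
  funext c
  exact perturb_map hdiag θ c

instance isProbabilityMeasure_posterior (z : ι → Example D K) (θ : Vec P) (α σ : ℝ) :
    IsProbabilityMeasure (posterior f z θ α σ) := by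
  unfold posterior
  infer_instance

instance isProbabilityMeasure_paramPosterior (z : ι → Example D K) (θ : Vec P) (α σ : ℝ) :
    IsProbabilityMeasure (paramPosterior f z θ α σ) := by
  unfold paramPosterior
  exact Measure.isProbabilityMeasure_map
    (measurable_perturb_uncurry.comp measurable_prodMk_left).aemeasurable

theorem measurableEmbedding_linearEquiv {P : ℕ} (T : Vec P ≃ₗ[ℝ] Vec P) :
    MeasurableEmbedding T :=
  T.toContinuousLinearEquiv.toHomeomorph.measurableEmbedding

theorem genErr_map (err : Vec K → Vec K → ℝ) (𝒟 : Measure (Example D K)) [SFinite 𝒟]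
    (Q : Measure (Vec P)) [SFinite Q] (hT : ∀ x ψ, f x (T ψ) = f x ψ) :
    genErr f err 𝒟 (Q.map T) = genErr f err 𝒟 Q := by
  have hTe : MeasurableEmbedding T := measurableEmbedding_linearEquiv T
  have hprod : 𝒟.prod (Q.map T) = (𝒟.prod Q).map (Prod.map id T) := by
    rw [← Measure.map_prod_map 𝒟 Q measurable_id hTe.measurable, Measure.map_id]
  rw [genErr, hprod, (MeasurableEmbedding.id.prodMap hTe).integral_map]
  simp [genErr, hT]

theorem empErr_map {N : ℕ} (err : Vec K → Vec K → ℝ) (z : Fin N → Example D K)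
    (Q : Measure (Vec P)) (hT : ∀ x ψ, f x (T ψ) = f x ψ) :
    empErr f err z (Q.map T) = empErr f err z Q := by
  have hTe : MeasurableEmbedding T := measurableEmbedding_linearEquiv T
  simp only [empErr, hTe.integral_map, hT]

end Invariance

theorem ctkBound_eq_of_comp_eq {D P K NP NQ : ℕ} {f : Vec D → Vec P → Vec K}
    {T : Vec P ≃ₗ[ℝ] Vec P} (hdiag : IsDiagonal T) (hT : ∀ x ψ, f x (T ψ) = f x ψ)
    (err : Vec K → Vec K → ℝ) (s : Fin NP ⊕ Fin NQ → Example D K)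
    (R : Finset (Fin NP ⊕ Fin NQ)) (θ : Vec P) (α σ δ : ℝ) :
    ctkBound f err s R (T θ) α σ δ = ctkBound f err s R θ α σ δ := by
  simp only [ctkBound, postMean_eq_of_comp_eq hdiag hT, beta_eq_of_comp_eq hdiag hT,
    paramPosterior_map hdiag hT, empErr_map err _ _ hT]

/-! ### The PAC-Bayes inequality. -/

section PACBayes

variable {D P K : ℕ} {f : Vec D → Vec P → Vec K} {err : Vec K → Vec K → ℝ}

/-- Error of the perturbed network on a single example. -/
def pointErr (f : Vec D → Vec P → Vec K) (err : Vec K → Vec K → ℝ) (θ c : Vec P)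
    (z : Example D K) : ℝ :=
  err (f z.1 (perturb θ c)) z.2

/-- Expected minus empirical error of the perturbed network. -/
noncomputable def errGap {N : ℕ} (f : Vec D → Vec P → Vec K) (err : Vec K → Vec K → ℝ)
    (𝒟 : Measure (Example D K)) (θ : Vec P) (s : Fin N → Example D K) (c : Vec P) : ℝ :=
  ∫ z, pointErr f err θ c z ∂𝒟 - (∑ j, pointErr f err θ c (s j)) / N

theorem measurable_pointErr (hf : Measurable fun w : Vec D × Vec P => f w.1 w.2)
    (herr : Measurable fun w : Vec K × Vec K => err w.1 w.2) :
    Measurable fun w : (Vec P × Vec P) × Example D K => pointErr f err w.1.1 w.1.2 w.2 := by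
  have h1 : Measurable fun w : (Vec P × Vec P) × Example D K => perturb w.1.1 w.1.2 :=
    measurable_perturb_uncurry.comp measurable_fst
  have h2 : Measurable fun w : (Vec P × Vec P) × Example D K => f w.2.1 (perturb w.1.1 w.1.2) :=
    hf.comp ((measurable_fst.comp measurable_snd).prodMk h1)
  exact herr.comp (h2.prodMk (measurable_snd.comp measurable_snd))

/-- Measurability is joint in parameter, sample and connectivity, as Tonelli and a random `θ`
require. -/
theorem measurable_errGap {N : ℕ} (𝒟 : Measure (Example D K)) [SFinite 𝒟]
    (hf : Measurable fun w : Vec D × Vec P => f w.1 w.2)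
    (herr : Measurable fun w : Vec K × Vec K => err w.1 w.2) :
    Measurable fun w : (Vec P × (Fin N → Example D K)) × Vec P =>
      errGap f err 𝒟 w.1.1 w.1.2 w.2 := by
  have hm := measurable_pointErr hf herr
  have h1 : Measurable fun w : Vec P × Vec P => ∫ z, pointErr f err w.1 w.2 z ∂𝒟 :=
    (StronglyMeasurable.integral_prod_right (f := fun (w : Vec P × Vec P) z => pointErr f err w.1 w.2 z)
      hm.stronglyMeasurable).measurable
  have hθc : Measurable fun w : (Vec P × (Fin N → Example D K)) × Vec P => (w.1.1, w.2) := by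
    fun_prop
  have h2 : ∀ j, Measurable fun w : (Vec P × (Fin N → Example D K)) × Vec P =>
      pointErr f err w.1.1 w.2 (w.1.2 j) := fun j =>
    hm.comp (hθc.prodMk ((measurable_pi_apply j).comp (measurable_snd.comp measurable_fst)))
  exact (h1.comp hθc).sub ((Finset.measurable_sum _ fun j _ => h2 j).div_const _)

theorem abs_errGap_le {N : ℕ} (𝒟 : Measure (Example D K)) [IsProbabilityMeasure 𝒟]
    (hf : Measurable fun w : Vec D × Vec P => f w.1 w.2)
    (herr : Measurable fun w : Vec K × Vec K => err w.1 w.2)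
    (herr01 : ∀ u v, err u v ∈ Set.Icc (0 : ℝ) 1) (θ : Vec P) (s : Fin N → Example D K)
    (c : Vec P) : |errGap f err 𝒟 θ s c| ≤ 1 := by
  have hX : Measurable (pointErr f err θ c) :=
    (measurable_pointErr hf herr).comp (measurable_prodMk_left (x := (θ, c)))
  have h01 : ∀ z, pointErr f err θ c z ∈ Set.Icc (0 : ℝ) 1 := fun z => herr01 _ _
  have hint : Integrable (pointErr f err θ c) 𝒟 :=
    Integrable.of_bound hX.aestronglyMeasurable 1 (ae_of_all _ fun z => by
      rw [Real.norm_eq_abs, abs_le]; exact ⟨by linarith [(h01 z).1], (h01 z).2⟩)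
  have hp0 : 0 ≤ ∫ z, pointErr f err θ c z ∂𝒟 := integral_nonneg fun z => (h01 z).1
  have hp1 : ∫ z, pointErr f err θ c z ∂𝒟 ≤ 1 := by
    have := integral_mono hint (integrable_const (1 : ℝ)) fun z => (h01 z).2
    simpa using this
  have hs0 : 0 ≤ (∑ j, pointErr f err θ c (s j)) / (N : ℝ) :=
    div_nonneg (Finset.sum_nonneg fun j _ => (h01 _).1) (Nat.cast_nonneg _)
  have hs1 : (∑ j, pointErr f err θ c (s j)) / (N : ℝ) ≤ 1 := by
    refine div_le_one_of_le₀ ?_ (Nat.cast_nonneg _)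
    have := Finset.sum_le_sum fun (j : Fin N) (_ : j ∈ Finset.univ) => (h01 (s j)).2
    simpa using this
  rw [errGap, abs_le]
  constructor <;> linarith

/-- The exponential moment of the squared error gap under the prior `ν`. -/
noncomputable def expMoment {N : ℕ} (f : Vec D → Vec P → Vec K) (err : Vec K → Vec K → ℝ)
    (𝒟 : Measure (Example D K)) (ν : Measure (Vec P)) (θ : Vec P) (s : Fin N → Example D K) :
    ℝ≥0∞ :=
  ∫⁻ c, ENNReal.ofReal (Real.exp (2 * N * errGap f err 𝒟 θ s c ^ 2)) ∂ν

theorem measurable_expMoment {N : ℕ} (𝒟 : Measure (Example D K)) [SFinite 𝒟]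
    (ν : Measure (Vec P)) [SFinite ν]
    (hf : Measurable fun w : Vec D × Vec P => f w.1 w.2)
    (herr : Measurable fun w : Vec K × Vec K => err w.1 w.2) :
    Measurable fun w : Vec P × (Fin N → Example D K) => expMoment f err 𝒟 ν w.1 w.2 := by
  have hm : Measurable fun w : (Vec P × (Fin N → Example D K)) × Vec P =>
      ENNReal.ofReal (Real.exp (2 * N * errGap f err 𝒟 w.1.1 w.1.2 w.2 ^ 2)) :=
    (((measurable_errGap 𝒟 hf herr).pow_const 2).const_mul _).exp.ennreal_ofReal
  unfold expMoment
  exact hm.lintegral_prod_right'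

/-- The prior does not depend on the sample, so Tonelli puts the sample average inside, where
`lintegral_exp_sq_le` applies for each `c`. -/
theorem lintegral_expMoment_le {N : ℕ} (hN : 0 < N) (𝒟 : Measure (Example D K))
    [IsProbabilityMeasure 𝒟] (ν : Measure (Vec P)) [IsProbabilityMeasure ν]
    (hf : Measurable fun w : Vec D × Vec P => f w.1 w.2)
    (herr : Measurable fun w : Vec K × Vec K => err w.1 w.2)
    (herr01 : ∀ u v, err u v ∈ Set.Icc (0 : ℝ) 1) (θ : Vec P) :
    ∫⁻ s : Fin N → Example D K, expMoment f err 𝒟 ν θ s ∂(Measure.pi fun _ => 𝒟)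
      ≤ ENNReal.ofReal (2 * √(N : ℝ)) := by
  unfold expMoment
  have hm := measurable_errGap (N := N) 𝒟 hf herr
  have hm' : Measurable fun w : (Fin N → Example D K) × Vec P => errGap f err 𝒟 θ w.1 w.2 :=
    hm.comp ((measurable_const.prodMk measurable_fst).prodMk measurable_snd)
  rw [lintegral_lintegral_swap (by fun_prop)]
  calc _ ≤ ∫⁻ _ : Vec P, ENNReal.ofReal (2 * √(N : ℝ)) ∂ν := lintegral_mono fun c =>
        lintegral_exp_sq_le 𝒟 ((measurable_pointErr hf herr).comp
          (measurable_prodMk_left (x := (θ, c)))) (fun z => herr01 _ _) hN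
    _ = _ := by simp

theorem integral_errGap {N : ℕ} (𝒟 : Measure (Example D K)) [IsProbabilityMeasure 𝒟]
    (Q : Measure (Vec P)) [IsProbabilityMeasure Q]
    (hf : Measurable fun w : Vec D × Vec P => f w.1 w.2)
    (herr : Measurable fun w : Vec K × Vec K => err w.1 w.2)
    (herr01 : ∀ u v, err u v ∈ Set.Icc (0 : ℝ) 1) (θ : Vec P) (s : Fin N → Example D K) :
    ∫ c, errGap f err 𝒟 θ s c ∂Q
      = genErr f err 𝒟 (Q.map (perturb θ)) - empErr f err s (Q.map (perturb θ)) := by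
  have hp : Measurable (perturb θ) := measurable_perturb_uncurry.comp measurable_prodMk_left
  have hm := measurable_pointErr hf herr
  have hmθ : Measurable fun w : Example D K × Vec P => pointErr f err θ w.2 w.1 :=
    hm.comp ((measurable_const.prodMk measurable_snd).prodMk measurable_fst)
  have hbd : ∀ c z, ‖pointErr f err θ c z‖ ≤ 1 := fun c z => by
    have := herr01 (f z.1 (perturb θ c)) z.2
    rw [Real.norm_eq_abs, abs_le]
    exact ⟨(by norm_num : (-1 : ℝ) ≤ 0).trans this.1, this.2⟩
  have hint : Integrable (fun w : Example D K × Vec P => pointErr f err θ w.2 w.1) (𝒟.prod Q) :=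
    Integrable.of_bound hmθ.aestronglyMeasurable 1 (ae_of_all _ fun w => hbd _ _)
  have hz : ∀ z, Integrable (fun c => pointErr f err θ c z) Q := fun z =>
    Integrable.of_bound (hmθ.comp measurable_prodMk_left).aestronglyMeasurable 1
      (ae_of_all _ fun c => hbd _ _)
  have hgen : genErr f err 𝒟 (Q.map (perturb θ)) = ∫ c, ∫ z, pointErr f err θ c z ∂𝒟 ∂Q := by
    have hprod : 𝒟.prod (Q.map (perturb θ)) = (𝒟.prod Q).map (Prod.map id (perturb θ)) := by
      rw [← Measure.map_prod_map 𝒟 Q measurable_id hp, Measure.map_id]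
    have hmeas : Measurable fun w : Example D K × Vec P => err (f w.1.1 w.2) w.1.2 :=
      herr.comp ((hf.comp ((measurable_fst.comp measurable_fst).prodMk measurable_snd)).prodMk
        (measurable_snd.comp measurable_fst))
    rw [genErr, hprod, integral_map (measurable_id.prodMap hp).aemeasurable
      hmeas.aestronglyMeasurable]
    exact integral_prod_symm _ hint
  have hemp : empErr f err s (Q.map (perturb θ))
      = ∫ c, (∑ j, pointErr f err θ c (s j)) / N ∂Q := by
    rw [integral_div, integral_finsetSum _ fun j _ => hz (s j), empErr, one_div_mul_eq_div]
    congr 1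
    refine Finset.sum_congr rfl fun j _ => ?_
    have hmeas : Measurable fun ψ : Vec P => err (f (s j).1 ψ) (s j).2 :=
      herr.comp ((hf.comp measurable_prodMk_left).prodMk measurable_const)
    rw [integral_map hp.aemeasurable hmeas.aestronglyMeasurable]
    rfl
  rw [hgen, hemp, ← integral_sub hint.integral_prod_right
    ((integrable_finsetSum _ fun j _ => hz (s j)).div_const _)]
  rfl

/-- The deterministic part of the PAC-Bayes theorem: a bound on the exponential moment under the
prior controls the error gap of every posterior. -/
theorem genErr_le_of_expMoment_le {N : ℕ} (hN : 0 < N) (𝒟 : Measure (Example D K))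
    [IsProbabilityMeasure 𝒟] (ν Q : Measure (Vec P)) [IsProbabilityMeasure ν]
    [IsProbabilityMeasure Q] (hkl : klDiv Q ν ≠ ∞)
    (hf : Measurable fun w : Vec D × Vec P => f w.1 w.2)
    (herr : Measurable fun w : Vec K × Vec K => err w.1 w.2)
    (herr01 : ∀ u v, err u v ∈ Set.Icc (0 : ℝ) 1) (θ : Vec P) (s : Fin N → Example D K)
    {B : ℝ} (hB : 0 < B) (hmom : expMoment f err 𝒟 ν θ s ≤ ENNReal.ofReal B) :
    genErr f err 𝒟 (Q.map (perturb θ)) ≤ empErr f err s (Q.map (perturb θ))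
      + √(((klDiv Q ν).toReal + Real.log B) / (2 * N)) := by
  have hN0 : (0 : ℝ) < N := by exact_mod_cast hN
  have hm : Measurable (errGap f err 𝒟 θ s) :=
    (measurable_errGap (N := N) 𝒟 hf herr).comp (measurable_prodMk_left (x := (θ, s)))
  have habs := abs_errGap_le 𝒟 hf herr herr01 θ s
  have hsq : ∀ c, errGap f err 𝒟 θ s c ^ 2 ≤ 1 := fun c => (sq_le_one_iff_abs_le_one _).2 (habs c)
  have hmem : MemLp (errGap f err 𝒟 θ s) 2 Q :=
    MemLp.of_bound hm.aestronglyMeasurable 1 (ae_of_all _ habs)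
  have hφ : Integrable (fun c => 2 * N * errGap f err 𝒟 θ s c ^ 2) Q :=
    hmem.integrable_sq.const_mul _
  have hexp : Integrable (fun c => Real.exp (2 * N * errGap f err 𝒟 θ s c ^ 2)) ν := by
    refine Integrable.of_bound (by fun_prop) (Real.exp (2 * N)) (ae_of_all _ fun c => ?_)
    rw [Real.norm_eq_abs, Real.abs_exp, Real.exp_le_exp]
    exact mul_le_of_le_one_right (by positivity) (hsq c)
  have hexpB : ∫ c, Real.exp (2 * N * errGap f err 𝒟 θ s c ^ 2) ∂ν ≤ B := by
    rw [← ENNReal.ofReal_le_ofReal_iff hB.le,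
      ofReal_integral_eq_lintegral_ofReal hexp (ae_of_all _ fun c => (Real.exp_pos _).le)]
    exact hmom
  have hDV := integral_le_klDiv_add_log hkl hφ hexp
  have hlog := Real.log_le_log (integral_exp_pos hexp) hexpB
  -- Nonnegative variance is the Jensen step (∫ gap)² ≤ ∫ gap².
  have hvar := variance_nonneg (errGap f err 𝒟 θ s) Q
  rw [variance_eq_sub hmem] at hvar
  simp only [Pi.pow_apply] at hvar
  rw [integral_const_mul] at hDV
  have hle : (∫ c, errGap f err 𝒟 θ s c ∂Q) ^ 2
      ≤ ((klDiv Q ν).toReal + Real.log B) / (2 * N) := by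
    rw [le_div_iff₀ (by positivity)]
    nlinarith
  have := (le_abs_self _).trans (Real.abs_le_sqrt hle)
  rw [integral_errGap 𝒟 Q hf herr herr01] at this
  linarith

/-- By independence the joint law is a product, so the bound for each fixed `a` averages over `X`;
Markov's inequality at level `C / δ` concludes. -/
theorem measure_ge_le_of_indepFun {Ω A B : Type*} [MeasurableSpace Ω] [MeasurableSpace A]
    [MeasurableSpace B] (μ : Measure Ω) [IsProbabilityMeasure μ] {X : Ω → A} {Y : Ω → B}
    (hX : Measurable X) (hY : Measurable Y) (hXY : IndepFun X Y μ) {G : A × B → ℝ≥0∞}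
    (hG : Measurable G) {C δ : ℝ} (hC : 0 < C) (hδ : 0 < δ)
    (hle : ∀ a, ∫⁻ b, G (a, b) ∂(μ.map Y) ≤ ENNReal.ofReal C) :
    μ {ω | ENNReal.ofReal (C / δ) ≤ G (X ω, Y ω)} ≤ ENNReal.ofReal δ := by
  have hjoint := (indepFun_iff_map_prod_eq_prod_map_map hX.aemeasurable hY.aemeasurable).1 hXY
  have : IsProbabilityMeasure (μ.map X) := Measure.isProbabilityMeasure_map hX.aemeasurable
  have : IsProbabilityMeasure (μ.map Y) := Measure.isProbabilityMeasure_map hY.aemeasurable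
  have hE : ∫⁻ ω, G (X ω, Y ω) ∂μ ≤ ENNReal.ofReal C := by
    rw [← lintegral_map hG (hX.prodMk hY), hjoint, lintegral_prod _ hG.aemeasurable]
    calc _ ≤ ∫⁻ _ : A, ENNReal.ofReal C ∂(μ.map X) := lintegral_mono hle
      _ = _ := by simp
  have hmeas : AEMeasurable (fun ω => G (X ω, Y ω)) μ := (hG.comp (hX.prodMk hY)).aemeasurable
  refine (meas_ge_le_lintegral_div hmeas
    (ENNReal.ofReal_pos.2 (div_pos hC hδ)).ne' ENNReal.ofReal_ne_top).trans ?_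
  refine (ENNReal.div_le_div_right hE _).trans ?_
  rw [← ENNReal.ofReal_div_of_pos (div_pos hC hδ), div_div_cancel₀ hC.ne']

theorem measure_expMoment_ge_le {Ω : Type*} [MeasurableSpace Ω] (μ : Measure Ω)
    [IsProbabilityMeasure μ] {N : ℕ} (hN : 0 < N) (𝒟 : Measure (Example D K))
    [IsProbabilityMeasure 𝒟] (ν : Measure (Vec P)) [IsProbabilityMeasure ν]
    (hf : Measurable fun w : Vec D × Vec P => f w.1 w.2)
    (herr : Measurable fun w : Vec K × Vec K => err w.1 w.2)
    (herr01 : ∀ u v, err u v ∈ Set.Icc (0 : ℝ) 1) {S : Fin N → Ω → Example D K}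
    (hSm : ∀ i, Measurable (S i)) (hSlaw : ∀ i, μ.map (S i) = 𝒟) (hSindep : iIndepFun S μ)
    {θ : Ω → Vec P} (hθm : Measurable θ) (hθindep : IndepFun θ (fun ω j => S j ω) μ)
    {δ : ℝ} (hδ : 0 < δ) :
    μ {ω | ENNReal.ofReal (2 * √(N : ℝ) / δ) ≤ expMoment f err 𝒟 ν (θ ω) fun j => S j ω}
      ≤ ENNReal.ofReal δ := by
  have hN0 : (0 : ℝ) < N := by exact_mod_cast hN
  have hSpi : μ.map (fun ω j => S j ω) = Measure.pi fun _ => 𝒟 := by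
    rw [(iIndepFun_iff_map_fun_eq_pi_map fun i => (hSm i).aemeasurable).1 hSindep]
    simp_rw [hSlaw]
  exact measure_ge_le_of_indepFun (G := fun w => expMoment f err 𝒟 ν w.1 w.2) μ hθm
    (measurable_pi_lambda _ hSm) hθindep (measurable_expMoment 𝒟 ν hf herr) (by positivity) hδ
    (by rw [hSpi]; exact fun t => lintegral_expMoment_le hN 𝒟 ν hf herr herr01 t)

end PACBayes

/-! ### Assembly of the bound and the main theorem. -/

theorem h_nonneg {x : ℝ} (hx : 0 < x) : 0 ≤ h x := by
  have := Real.log_le_sub_one_of_pos hx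
  unfold h
  linarith

instance isProbabilityMeasure_prior (P : ℕ) (α : ℝ) : IsProbabilityMeasure (prior P α) := by
  unfold prior
  infer_instance

theorem genErr_le_ctkBound {D P K NP NQ : ℕ} (hNQ : 0 < NQ) {f : Vec D → Vec P → Vec K}
    {err : Vec K → Vec K → ℝ} (𝒟 : Measure (Example D K)) [IsProbabilityMeasure 𝒟]
    (hf : Measurable fun w : Vec D × Vec P => f w.1 w.2)
    (herr : Measurable fun w : Vec K × Vec K => err w.1 w.2)
    (herr01 : ∀ u v, err u v ∈ Set.Icc (0 : ℝ) 1) (s : Fin NP ⊕ Fin NQ → Example D K)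
    (R : Finset (Fin NP ⊕ Fin NQ)) (θ : Vec P) {α σ δ : ℝ} (hα : 0 < α) (hδ : 0 < δ)
    (hmom : expMoment f err 𝒟 (prior P α) θ (fun j => s (Sum.inr j))
      ≤ ENNReal.ofReal (2 * √(NQ : ℝ) / δ)) :
    genErr f err 𝒟 (paramPosterior f (fun i : R => s i) θ α σ) ≤ ctkBound f err s R θ α σ δ := by
  have hN0 : (0 : ℝ) < NQ := by exact_mod_cast hNQ
  have hkl := klDiv_posterior_prior f (fun i : R => s i) θ (σ := σ) hα
  have hmain := genErr_le_of_expMoment_le hNQ 𝒟 (prior P α) (posterior f (fun i : R => s i) θ α σ)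
    (by rw [hkl]; exact ENNReal.ofReal_ne_top) hf herr herr01 θ (fun j => s (Sum.inr j))
    (by positivity) hmom
  refine hmain.trans_eq ?_
  rw [hkl, ENNReal.toReal_ofReal]
  · simp only [ctkBound, paramPosterior]
    congr 2
    rw [← Finset.sum_div]
    field_simp
    ring
  · refine add_nonneg (div_nonneg (Finset.sum_nonneg fun p _ => mul_self_nonneg _) (by positivity))
      (div_nonneg (Finset.sum_nonneg fun p _ => h_nonneg (beta_pos _ _ _ p)) (by norm_num))

end PACBayesCTK

theorem theorem1 {Ω : Type*} [MeasurableSpace Ω] (μ : Measure Ω) [IsProbabilityMeasure μ]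
    {D P K NP NQ : ℕ} (hNQ : 0 < NQ)
    (𝒟 : Measure (PACBayesCTK.Example D K)) [IsProbabilityMeasure 𝒟]
    (f : PACBayesCTK.Vec D → PACBayesCTK.Vec P → PACBayesCTK.Vec K)
    (hf : Measurable fun w : PACBayesCTK.Vec D × PACBayesCTK.Vec P => f w.1 w.2)
    (err : PACBayesCTK.Vec K → PACBayesCTK.Vec K → ℝ)
    (herr : Measurable fun w : PACBayesCTK.Vec K × PACBayesCTK.Vec K => err w.1 w.2)
    (herr01 : ∀ u v, err u v ∈ Set.Icc (0 : ℝ) 1)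
    -- the i.i.d. training sample; its two parts are indexed by `Sum.inl` and `Sum.inr`
    (S : Fin NP ⊕ Fin NQ → Ω → PACBayesCTK.Example D K)
    (hSm : ∀ i, Measurable (S i)) (hSlaw : ∀ i, μ.map (S i) = 𝒟) (hSindep : iIndepFun S μ)
    -- the examples used in the Bayesian linear regression (`Finset.univ` for the whole sample)
    (R : Finset (Fin NP ⊕ Fin NQ))
    -- the pre-trained parameter, independent of the second part of the sample
    (θ : Ω → PACBayesCTK.Vec P) (hθm : Measurable θ)
    (hθindep : IndepFun θ (fun ω (j : Fin NQ) => S (Sum.inr j) ω) μ)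
    (hdiff : ∀ᵐ ω ∂μ, ∀ i ∈ R, DifferentiableAt ℝ (f (S i ω).1) (θ ω))
    (α σ δ : ℝ) (hα : 0 < α) (hσ : 0 < σ) (hδ : 0 < δ) (hδ1 : δ ≤ 1) :
    -- the bound holds with probability at least `1 - δ`
    μ {ω | ¬ PACBayesCTK.genErr f err 𝒟
          (PACBayesCTK.paramPosterior f (fun i : R => S i ω) (θ ω) α σ)
        ≤ PACBayesCTK.ctkBound f err (fun i => S i ω) R (θ ω) α σ δ} ≤ ENNReal.ofReal δ ∧
    ∀ (θ₀ : PACBayesCTK.Vec P) (s : Fin NP ⊕ Fin NQ → PACBayesCTK.Example D K),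
      (∀ i ∈ R, DifferentiableAt ℝ (f (s i).1) θ₀) →
      -- its first two terms under the root are the Kullback-Leibler divergence over `2 N_Q`
      klDiv (PACBayesCTK.posterior f (fun i : R => s i) θ₀ α σ) (PACBayesCTK.prior P α)
        = ENNReal.ofReal
          ((∑ p, PACBayesCTK.postMean f (fun i : R => s i) θ₀ α σ p
              * PACBayesCTK.postMean f (fun i : R => s i) θ₀ α σ p) / (2 * α ^ 2)
            + (∑ p, PACBayesCTK.h (PACBayesCTK.beta f (fun i : R => s i) θ₀ α σ p)) / 2) ∧
      -- both sides are invariant under function-preserving invertible diagonal linear maps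
      ∀ T : PACBayesCTK.Vec P ≃ₗ[ℝ] PACBayesCTK.Vec P, PACBayesCTK.IsDiagonal T →
        (∀ x ψ, f x (T ψ) = f x ψ) →
        PACBayesCTK.genErr f err 𝒟
            (PACBayesCTK.paramPosterior f (fun i : R => s i) (T θ₀) α σ)
          = PACBayesCTK.genErr f err 𝒟
            (PACBayesCTK.paramPosterior f (fun i : R => s i) θ₀ α σ) ∧
        PACBayesCTK.ctkBound f err s R (T θ₀) α σ δ
          = PACBayesCTK.ctkBound f err s R θ₀ α σ δ := by
  refine ⟨?_, fun θ₀ s _ => ⟨PACBayesCTK.klDiv_posterior_prior f _ θ₀ hα, fun T hdiag hT => ⟨?_,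
    PACBayesCTK.ctkBound_eq_of_comp_eq hdiag hT err s R θ₀ α σ δ⟩⟩⟩
  -- Failure of the bound forces a large exponential moment under the prior. This inclusion
  -- suffices: the failure event need not be measurable, and the posterior stays out of the
  -- probability estimate.
  · refine (measure_mono fun ω hω => ?_).trans
      (PACBayesCTK.measure_expMoment_ge_le μ hNQ 𝒟 (PACBayesCTK.prior P α) hf herr herr01
        (fun j => hSm (Sum.inr j)) (fun j => hSlaw (Sum.inr j))
        (hSindep.precomp Sum.inr_injective) hθm hθindep hδ)
    by_contra hlt
    exact hω (PACBayesCTK.genErr_le_ctkBound hNQ 𝒟 hf herr herr01 (fun i => S i ω) R (θ ω) hα hδ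
      (not_le.1 hlt).le)
  · rw [PACBayesCTK.paramPosterior_map hdiag hT, PACBayesCTK.genErr_map err 𝒟 _ hT]
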